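/- Let $\mathbb F_q$ be a fixed finite field of order $q$ and let $k\ge 2$ be a fixed integer. For $g\in\mathbb F_q[T]$ put $|g|=q^{\deg g}$ if $g\neq 0$ and $|0|=0$. For $s\in\mathbb F_q[T]$ and a positive integer $m$ let $$\mathcal I_m(s)=\{x\in\mathbb F_q[T] : |x-s|<q^m\}.$$ For $F\in\mathbb F_q[T]$ and finite $\mathcal S\subseteq\mathbb F_q[T]$ let $E^{\mathrm{inv}}_{F,k}(\mathcal S)$ be the number of $2k$-tuples $(x_1,\dots,x_{2k})\in\mathcal S^{2k}$ with all $x_i$ coprime to $F$ such that $$\overline{x_1}+\dots+\overline{x_k}\equiv\overline{x_{k+1}}+\dots+\overline{x_{2k}}\pmod F,$$ where $\overline{x}$ denotes the multiplicative inverse of $x$ modulo $F$. Then there is a function $\varepsilon:\mathbb N\to\mathbb R$, depending only on $\mathbb F_q$ and $k$, with $\varepsilon(m)=o(m)$ as $m\to\infty$, such that for every irreducible $F\in\mathbb F_q[T]$, with $r=\deg F$, every $s\in\mathbb F_q[T]$ and every positive integer $m$ satisfying $$m<\left(1-\frac{3k}{2r}\right)\frac{r}{4k^2-4k+5},$$ one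 has $$E^{\mathrm{inv}}_{F,k}\left(\mathcal I_m(s)\right)\le q^{km+\varepsilon(m)}.$$ -/

import Mathlib

open Polynomial

/-- The interval `I_m(s)`: all polynomials `x` over the finite field `𝔽` of order `q` with
`|x - s| < q ^ m`, where `|g| = q ^ deg g` for `g ≠ 0` and `|0| = 0`. -/
def polyInterval {𝔽 : Type*} [Field 𝔽] [Fintype 𝔽] (m : ℕ) (s : 𝔽[X]) : Set 𝔽[X] :=
  {x | cardPowDegree (x - s) < (Fintype.card 𝔽 : ℤ) ^ m}

theorem mem_polyInterval {𝔽 : Type*} [Field 𝔽] [Fintype 𝔽] (m : ℕ) (s x : 𝔽[X]) :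
    x ∈ polyInterval m s ↔ (x - s).degree < m := by
  have hq : (1 : ℤ) < (Fintype.card 𝔽 : ℤ) := by exact_mod_cast Fintype.one_lt_card
  by_cases h : x - s = 0
  · have : (0 : ℤ) < (Fintype.card 𝔽 : ℤ) ^ m := by positivity
    simp [polyInterval, h, this]
  · simp only [polyInterval, Set.mem_ofPred_eq, cardPowDegree_nonzero _ h,
      pow_lt_pow_iff_right₀ hq, natDegree_lt_iff_degree_lt h]

/-- Intervals are finite, so that the cardinalities below are genuine. -/
theorem finite_polyInterval {𝔽 : Type*} [Field 𝔽] [Fintype 𝔽] (m : ℕ) (s : 𝔽[X]) :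
    (polyInterval m s).Finite := by
  have hfin : Finite (degreeLT 𝔽 m) := Finite.of_equiv _ (degreeLTEquiv 𝔽 m).symm.toEquiv
  refine ((Set.toFinite (degreeLT 𝔽 m : Set 𝔽[X])).image (fun y => y + s)).subset ?_
  intro x hx
  exact ⟨x - s, mem_degreeLT.2 ((mem_polyInterval m s x).1 hx), by ring⟩

/-- The inverse of `x` modulo `F`, reduced modulo `F`. It is meaningful when `gcd (x, F) = 1`
(and is set to `0` otherwise). -/
noncomputable def invMod {𝔽 : Type*} [Field 𝔽] (F x : 𝔽[X]) : 𝔽[X] :=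
  open Classical in if h : IsCoprime x F then h.choose % F else 0

theorem dvd_mul_invMod_sub_one {𝔽 : Type*} [Field 𝔽] {F x : 𝔽[X]} (h : IsCoprime x F) :
    F ∣ x * invMod F x - 1 := by
  obtain ⟨b, hb⟩ := h.choose_spec
  have hdiv := EuclideanDomain.div_add_mod h.choose F
  rw [invMod, dif_pos h]
  refine ⟨-(b + x * (h.choose / F)), ?_⟩
  linear_combination hb + x * hdiv

/-- The Kloosterman energy: the number of `2k`-tuples `(x₁, …, x_k, y₁, …, y_k)` of elements of
`S`, all coprime to `F` (so that the inverses modulo `F` exist), with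
`x₁⁻¹ + ⋯ + x_k⁻¹ ≡ y₁⁻¹ + ⋯ + y_k⁻¹ (mod F)`. -/
noncomputable def kloostermanEnergy {𝔽 : Type*} [Field 𝔽] (F : 𝔽[X]) (k : ℕ) (S : Set 𝔽[X]) : ℕ :=
  Set.ncard {p : (Fin k → 𝔽[X]) × (Fin k → 𝔽[X]) |
    (∀ i, p.1 i ∈ S ∧ IsCoprime (p.1 i) F) ∧
    (∀ i, p.2 i ∈ S ∧ IsCoprime (p.2 i) F) ∧
    F ∣ ∑ i, invMod F (p.1 i) - ∑ i, invMod F (p.2 i)}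

theorem finite_kloostermanEnergy {𝔽 : Type*} [Field 𝔽] (F : 𝔽[X]) (k : ℕ) {S : Set 𝔽[X]}
    (hS : S.Finite) :
    {p : (Fin k → 𝔽[X]) × (Fin k → 𝔽[X]) |
      (∀ i, p.1 i ∈ S ∧ IsCoprime (p.1 i) F) ∧
      (∀ i, p.2 i ∈ S ∧ IsCoprime (p.2 i) F) ∧
      F ∣ ∑ i, invMod F (p.1 i) - ∑ i, invMod F (p.2 i)}.Finite := by
  have h1 : (Set.univ.pi fun _ : Fin k => S).Finite := Set.Finite.pi fun _ => hS
  refine (h1.prod h1).subset ?_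
  rintro p ⟨hx, hy, -⟩
  exact ⟨fun i _ => (hx i).1, fun i _ => (hy i).1⟩

/-! Write `x_i = s + y_i` with `deg y_i < m`. Clearing denominators turns the congruence into `F ∣
P_y(s)`, where `P_y(S) = ∑ ε_i ∏_{j ≠ i} (S + y_j)` and `ε_i = ±1`. Give `T` weight 1 and `S` weight
`m`: each `P_y` has weight at most `(2k-1)m`, so the resultant of two of them has degree at most
`(2k-1)² m < deg F`. The bound is applied to an irreducible factor `R` of one nonzero `P_y` with `F
∣ R(s)`: its resultant with any other `P_z` is divisible by `F`, hence vanishes, and `R` divides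
every `P_z` (`exists_irreducible_dvd_of_dvd_eval`).

Thus `∑ ε_i / (σ + y_i) = 0` at every root `σ` of `R`, an exact identity free of `F`. Let `B(y)`
generate the ideal of those `b` with all `b / (σ + y)` integral (`exists_conductor`). The identity
forces `B(y_t)` to divide the lcm of the differences `y_j - y_t`, `j ≠ t`, while `R(-y)` divides
`lc(R) B(y)^{deg R}`. So a small `B(y)` makes `R(-y)` small, which cannot happen at more than `deg
R` well separated points.

For counting, choose the coordinates one after another. Given the set `Y` of those already chosen,
the divisors `gcd(B(y), s - y)`, `s ∈ Y`, take few values by the divisor bound, and fixing them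
together with `deg B(y)` leaves `O(q^e)` choices, `e` being the `excess` (`sum_inv_pow_excess_le`).
For a solution, the excesses of `y_t` relative to the later and to the earlier coordinates add up to
at most `m + 1` (`excess_add_excess_le`). Hence one of the two orders has total excess at most `k(m
+ 1)`, and summing over both orders gives `q^{km}` up to a subexponential factor
(`card_le_of_sum_inv_pow_le`). -/

/-! ### Integrality of `L / (σ + y)` and the conductor `B(y)` -/

section Conductor

/-- The numerator of `∑ i, ε i / (S + y i)` over the common denominator `∏ i, (S + y i)`. -/
noncomputable def reciprocalNumerator {A ι : Type*} [CommRing A] [Fintype ι] [DecidableEq ι]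
    (ε y : ι → A) : A[X] :=
  ∑ i, C (ε i) * ∏ j ∈ Finset.univ.erase i, (X + C (y j))

/-- With `w = σ + y_t`, `u = L / w` and `L = (y_j - y_t) l_j`, one has `l_j + u = (l_j / w)(σ +
y_j)`. Substituting this in the vanishing numerator and dividing by `ε_t` gives the monic equation
`∏ (l_j + u) + ∑ η ε_i l_i ∏_{j ≠ i} (l_j + u) = 0`, with all indices different from `t`. -/
theorem isIntegral_div_of_aeval_reciprocalNumerator_eq_zero {A Ω ι : Type*} [CommRing A] [Field Ω]
    [Algebra A Ω] [Fintype ι] [DecidableEq ι] {ε y : ι → A} {σ : Ω} {t : ι} {η L : A}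
    (hP : aeval σ (reciprocalNumerator ε y) = 0) (hη : η * ε t = 1)
    (hσ : σ + algebraMap A Ω (y t) ≠ 0) (hL : ∀ j ≠ t, y j - y t ∣ L) :
    IsIntegral A (algebraMap A Ω L / (σ + algebraMap A Ω (y t))) := by
  nontriviality A
  have hc : ∀ j, ∃ c, j ≠ t → L = (y j - y t) * c := by
    intro j
    by_cases h : j = t
    · exact ⟨0, fun h' => absurd h h'⟩
    · obtain ⟨c, hc⟩ := hL j h
      exact ⟨c, fun _ => hc⟩
  choose l hl using hc
  set E : Finset ι := Finset.univ.erase t with hE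
  set a := algebraMap A Ω with ha
  set w : Ω := σ + a (y t) with hw
  set u : Ω := a L / w with hu
  let g : A[X] := ∑ i ∈ E, C (η * ε i * l i) * ∏ j ∈ E.erase i, (X + C (l j))
  have hmon : (∏ j ∈ E, (X + C (l j))).Monic := monic_prod_of_monic _ _ fun j _ => monic_X_add_C _
  have hnat : ∀ s : Finset ι, (∏ j ∈ s, (X + C (l j))).natDegree = s.card := by
    intro s
    rw [natDegree_prod_of_monic _ _ fun j _ => monic_X_add_C _]
    simp
  have hdeg : g.degree < (∏ j ∈ E, (X + C (l j))).degree := by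
    rw [degree_eq_natDegree hmon.ne_zero, hnat]
    refine (degree_sum_le _ _).trans_lt ?_
    rw [Finset.sup_lt_iff (WithBot.bot_lt_coe _)]
    intro i hi
    refine degree_le_natDegree.trans_lt ?_
    refine (WithBot.coe_le_coe.2 (natDegree_C_mul_le _ _)).trans_lt ?_
    rw [hnat, Finset.card_erase_of_mem hi]
    exact WithBot.coe_lt_coe.2 (Nat.pred_lt (Finset.card_ne_zero_of_mem hi))
  refine ⟨∏ j ∈ E, (X + C (l j)) + g, hmon.add_of_left hdeg, ?_⟩
  have key : ∀ j ∈ E, a (l j) + u = a (l j) * w⁻¹ * (σ + a (y j)) := by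
    intro j hj
    have h1 := congrArg a (hl j (Finset.ne_of_mem_erase hj))
    simp only [map_mul, map_sub] at h1
    rw [hu, h1, hw]
    rw [hw] at hσ
    field_simp
    ring
  have hterm : ∀ i ∈ E, a (l i) * ∏ j ∈ E.erase i, (a (l j) + u) =
      (∏ j ∈ E, (a (l j) * w⁻¹)) * ∏ j ∈ Finset.univ.erase i, (σ + a (y j)) := by
    intro i hi
    have hti : t ∈ Finset.univ.erase i :=
      Finset.mem_erase.2 ⟨(Finset.ne_of_mem_erase hi).symm, Finset.mem_univ _⟩
    rw [← Finset.mul_prod_erase _ _ hti, Finset.erase_right_comm (a := i), ← hE, ← hw,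
      Finset.prod_congr rfl fun j hj => key j (Finset.mem_of_mem_erase hj),
      Finset.prod_mul_distrib, ← Finset.mul_prod_erase _ _ hi]
    field_simp
  have h0 : ∏ j ∈ E, (a (l j) + u) =
      (∏ j ∈ E, (a (l j) * w⁻¹)) * ∏ j ∈ E, (σ + a (y j)) := by
    rw [Finset.prod_congr rfl key, Finset.prod_mul_distrib]
  have hP' : ∑ i, a (ε i) * ∏ j ∈ Finset.univ.erase i, (σ + a (y j)) = 0 := by
    simpa [reciprocalNumerator, map_sum, map_prod] using hP
  rw [← Finset.add_sum_erase _ _ (Finset.mem_univ t), ← hE] at hP'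
  have hη' : a η * a (ε t) = 1 := by rw [← map_mul, hη, map_one]
  have hsum : eval₂ (algebraMap A Ω) u (∏ j ∈ E, (X + C (l j)) + g) =
      ∏ j ∈ E, (a (l j) + u) +
        ∑ i ∈ E, a η * a (ε i) * (a (l i) * ∏ j ∈ E.erase i, (a (l j) + u)) := by
    simp only [g, eval₂_add, eval₂_finsetSum, eval₂_finsetProd, eval₂_mul, eval₂_C, eval₂_X,
      map_mul, ← ha, mul_assoc, add_comm u]
  rw [hsum, Finset.sum_congr rfl fun i hi => by rw [hterm i hi], h0]
  calc _ = a η * (∏ j ∈ E, (a (l j) * w⁻¹)) * (a (ε t) * ∏ j ∈ E, (σ + a (y j)) +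
        ∑ i ∈ E, a (ε i) * ∏ j ∈ Finset.univ.erase i, (σ + a (y j))) := by
        rw [mul_add, Finset.mul_sum]
        congr 1
        · linear_combination (-(∏ j ∈ E, (a (l j) * w⁻¹)) * ∏ j ∈ E, (σ + a (y j))) * hη'
        · exact Finset.sum_congr rfl fun i _ => by ring
    _ = 0 := by rw [hP', mul_zero]

/-- Expand `R` at `-y`: the constant term is `R(-y)`, so `1 / (σ + y)` is a root of the reversed
polynomial, whose leading coefficient is `R(-y)`. -/
theorem isIntegral_eval_neg_div {A Ω : Type*} [CommRing A] [IsDomain A] [Field Ω] [Algebra A Ω]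
    {R : A[X]} {σ : Ω} {y : A} (hσ : aeval σ R = 0) (hy : R.eval (-y) ≠ 0)
    (hw : σ + algebraMap A Ω y ≠ 0) :
    IsIntegral A (algebraMap A Ω (R.eval (-y)) / (σ + algebraMap A Ω y)) := by
  set f := taylor (-y) R with hf
  have hc : f.coeff 0 = R.eval (-y) := by rw [hf, taylor_coeff_zero]
  have hf0 : aeval (σ + algebraMap A Ω y) f = 0 := by
    rw [hf, taylor_apply, aeval_comp]
    simpa using hσ
  have hlead : f.reverse.leadingCoeff = R.eval (-y) := by
    rw [reverse_leadingCoeff, trailingCoeff, natTrailingDegree_eq_zero.2 (Or.inr (hc ▸ hy)), hc]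
  have hroot : aeval ((σ + algebraMap A Ω y)⁻¹) f.reverse = 0 := by
    have := invertibleOfNonzero hw
    have h := (eval₂_reverse_eq_zero_iff (algebraMap A Ω) (σ + algebraMap A Ω y) f).2 hf0
    rwa [invOf_eq_inv] at h
  have := isIntegral_leadingCoeff_smul f.reverse _ hroot
  rwa [hlead, Algebra.smul_def, ← div_eq_mul_inv] at this

/-- Up to sign `R(-y) = lc(R) ∏ (σ + y)`. The product of the integral elements `b / (σ + y)` is
therefore `± lc(R) b^{deg R} / R(-y)`, which lies in `K` and hence in `A`. -/
theorem eval_neg_dvd_of_isIntegral {A K Ω : Type*} [CommRing A] [IsDomain A]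
    [IsIntegrallyClosed A] [Field K] [Algebra A K] [IsFractionRing A K] [Field Ω] [Algebra A Ω]
    [Algebra K Ω] [IsScalarTower A K Ω] [IsAlgClosed Ω] {R : A[X]} {y b : A}
    (hy : R.eval (-y) ≠ 0)
    (hb : ∀ σ ∈ R.aroots Ω, IsIntegral A (algebraMap A Ω b / (σ + algebraMap A Ω y))) :
    R.eval (-y) ∣ R.leadingCoeff * b ^ R.natDegree := by
  have hinj : Function.Injective (algebraMap A Ω) := by
    rw [IsScalarTower.algebraMap_eq A K Ω]
    exact (algebraMap K Ω).injective.comp (IsFractionRing.injective A K)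
  set a := algebraMap A Ω with ha
  have hR0 : R ≠ 0 := fun h => hy (by simp [h])
  have hmap : (R.map a).roots = R.aroots Ω := rfl
  have hcard : Multiset.card (R.aroots Ω) = R.natDegree := by
    rw [← hmap, ← (IsAlgClosed.splits (R.map a)).natDegree_eq_card_roots,
      natDegree_map_eq_of_injective hinj]
  have hev : a (R.eval (-y)) =
      a R.leadingCoeff * ((-1) ^ R.natDegree * ((R.aroots Ω).map fun σ => σ + a y).prod) := by
    have h := (IsAlgClosed.splits (R.map a)).eval_eq_prod_roots (a (-y))
    rw [eval_map_apply, leadingCoeff_map_of_injective hinj, hmap] at h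
    rw [h, ← hcard]
    congr 1
    rw [← Multiset.card_map (fun σ => σ + a y), ← Multiset.prod_map_neg, Multiset.map_map]
    congr 1
    refine Multiset.map_congr rfl fun σ _ => ?_
    simp only [map_neg, Function.comp_apply]
    ring
  have hint : IsIntegral A (((R.aroots Ω).map fun σ => a b / (σ + a y)).prod) := by
    refine IsIntegral.multiset_prod fun z hz => ?_
    obtain ⟨σ, hσ, rfl⟩ := Multiset.mem_map.1 hz
    exact hb σ hσ
  have hprod : ((R.aroots Ω).map fun σ => a b / (σ + a y)).prod =
      a b ^ R.natDegree / ((R.aroots Ω).map fun σ => σ + a y).prod := by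
    rw [Multiset.prod_map_div, Multiset.map_const', Multiset.prod_replicate, hcard]
  set Q := ((R.aroots Ω).map fun σ => σ + a y).prod with hQ
  have hne : a (R.eval (-y)) ≠ 0 := fun h => hy (hinj (by simpa using h))
  have hQ0 : Q ≠ 0 := by
    intro h
    rw [h] at hev
    exact hne (by simpa using hev)
  have hl0 : a R.leadingCoeff ≠ 0 := fun h => hne (by rw [hev, h, zero_mul])
  rw [hprod] at hint
  have hrat : a b ^ R.natDegree / Q = algebraMap K Ω
      (algebraMap A K ((-1) ^ R.natDegree * R.leadingCoeff * b ^ R.natDegree) /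
        algebraMap A K (R.eval (-y))) := by
    rw [map_div₀, ← IsScalarTower.algebraMap_apply, ← IsScalarTower.algebraMap_apply, ← ha, hev]
    simp only [map_mul, map_pow, map_neg, map_one]
    have : ((-1 : Ω)) ^ R.natDegree ≠ 0 := by simp
    field_simp
  rw [hrat, isIntegral_algebraMap_iff (algebraMap K Ω).injective,
    IsIntegrallyClosed.isIntegral_iff] at hint
  obtain ⟨c, hc⟩ := hint
  have hne' : algebraMap A K (R.eval (-y)) ≠ 0 := by
    rwa [Ne, IsFractionRing.to_map_eq_zero_iff]
  rw [eq_div_iff hne', ← map_mul] at hc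
  have hc' := IsFractionRing.injective A K hc
  have h1 : ((-1 : A) ^ R.natDegree) * (-1) ^ R.natDegree = 1 := by
    rw [← mul_pow]; simp
  exact ⟨(-1) ^ R.natDegree * c, by
    linear_combination (-(-1) ^ R.natDegree) * hc' - R.leadingCoeff * b ^ R.natDegree * h1⟩

/-- To `y` with `R (-y) ≠ 0` one attaches a generator `B` of the ideal of those `b` for which
`b / (σ + y)` is integral for every root `σ` of `R`. -/
theorem exists_conductor {A : Type*} [CommRing A] [IsDomain A] [IsPrincipalIdealRing A]
    {R : A[X]} {y : A} (hy : R.eval (-y) ≠ 0) :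
    ∃ B : A, B ∣ R.eval (-y) ∧ R.eval (-y) ∣ R.leadingCoeff * B ^ R.natDegree ∧
      ∀ (n : ℕ) (ε z : Fin n → A) (t : Fin n), z t = y → IsUnit (ε t) →
        R ∣ reciprocalNumerator ε z → ∀ L, (∀ j ≠ t, z j - y ∣ L) → B ∣ L := by
  let K := FractionRing A
  let Ω := AlgebraicClosure K
  let I : Ideal A :=
    { carrier := {b | ∀ σ ∈ R.aroots Ω, IsIntegral A (algebraMap A Ω b / (σ + algebraMap A Ω y))}
      zero_mem' := fun σ _ => by simpa using isIntegral_zero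
      add_mem' := fun {b c} hb hc σ hσ => by
        rw [map_add, add_div]
        exact (hb σ hσ).add (hc σ hσ)
      smul_mem' := fun c b hb σ hσ => by
        rw [smul_eq_mul, map_mul, mul_div_assoc]
        exact isIntegral_algebraMap.mul (hb σ hσ) }
  have hinj : Function.Injective (algebraMap A Ω) := by
    rw [IsScalarTower.algebraMap_eq A K Ω]
    exact (algebraMap K Ω).injective.comp (IsFractionRing.injective A K)
  have hw : ∀ σ ∈ R.aroots Ω, σ + algebraMap A Ω y ≠ 0 := by
    intro σ hσ h
    have h0 := (mem_aroots'.1 hσ).2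
    rw [eq_neg_of_add_eq_zero_left h, ← map_neg, aeval_algebraMap_apply] at h0
    exact hy (hinj (by simpa using h0))
  have hmem : ∀ b ∈ I, Submodule.IsPrincipal.generator I ∣ b := fun b hb =>
    (Submodule.IsPrincipal.mem_iff_generator_dvd I).1 hb
  refine ⟨Submodule.IsPrincipal.generator I, hmem _ ?_, ?_, ?_⟩
  · intro σ hσ
    exact isIntegral_eval_neg_div (mem_aroots'.1 hσ).2 hy (hw σ hσ)
  · exact eval_neg_dvd_of_isIntegral (K := K) (Ω := Ω) hy
      (Submodule.IsPrincipal.generator_mem I)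
  · rintro n ε z t rfl hε hR L hL
    refine hmem _ fun σ hσ => ?_
    obtain ⟨η, hη⟩ := hε.exists_left_inv
    refine isIntegral_div_of_aeval_reciprocalNumerator_eq_zero (ε := ε) ?_ hη (hw σ hσ) hL
    obtain ⟨Q, hQ⟩ := hR
    rw [hQ, map_mul, (mem_aroots'.1 hσ).2, zero_mul]

end Conductor

/-! ### Small values at separated points -/

section Separation

/-- A polynomial of degree `d` cannot be small at `d + 1` points far from each other. -/
theorem false_of_natDegree_eval_le_of_separated {𝔽 : Type*} [Field 𝔽] {R : 𝔽[X][X]} (hd : R.natDegree ≠ 0)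
    {μ : ℕ}
    {Z : Finset 𝔽[X]} (hcard : Z.card = R.natDegree + 1)
    (hsep : ∀ x ∈ Z, ∀ y ∈ Z, x ≠ y → μ < (x - y).natDegree)
    (hval : ∀ x ∈ Z, (R.eval x).natDegree ≤ R.leadingCoeff.natDegree + R.natDegree * μ) :
    False := by
  classical
  have hR : R ≠ 0 := ne_zero_of_natDegree_gt (Nat.pos_of_ne_zero hd)
  let a := algebraMap 𝔽[X] (RatFunc 𝔽)
  have hinj : Function.Injective a := RatFunc.algebraMap_injective 𝔽
  let v := RatFunc.inftyValuation 𝔽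
  have hv : ∀ p : 𝔽[X], p ≠ 0 → v (a p) = WithZero.exp (p.natDegree : ℤ) := fun p hp => by
    simp only [v, RatFunc.inftyValuation_apply]
    exact RatFunc.inftyValuation.polynomial 𝔽 hp
  -- Lagrange interpolation: `lc(R) = ∑ R(x) / ∏ (x - z)`. Each denominator has degree at least `deg
  -- R (μ + 1)`, so every term has degree below that of `lc(R)`, contradicting the ultrametric
  -- inequality.
  have hlead := Lagrange.leadingCoeff_eq_sum (s := Z) (v := fun x => a x) (P := R.map a)
    hinj.injOn (by
      rw [degree_map_eq_of_injective hinj, degree_eq_natDegree hR, hcard]; norm_cast)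
  rw [leadingCoeff_map_of_injective hinj] at hlead
  have hl0 : R.leadingCoeff ≠ 0 := leadingCoeff_ne_zero.2 hR
  have hlt : v (a R.leadingCoeff) < v (a R.leadingCoeff) := by
    conv_lhs => rw [hlead]
    refine Valuation.map_sum_lt v ((Valuation.ne_zero_iff v).2 fun h => hl0 (hinj (by simpa using h))) ?_
    intro x hx
    rw [eval_map_apply]
    by_cases h0 : R.eval x = 0
    · rw [h0, map_zero, zero_div, map_zero, hv _ hl0]
      exact WithZero.exp_pos
    · have hne : ∀ z ∈ Z.erase x, x - z ≠ 0 := fun z hz =>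
        sub_ne_zero.2 (Finset.ne_of_mem_erase hz).symm
      have hprod : (∏ z ∈ Z.erase x, (a x - a z)) = a (∏ z ∈ Z.erase x, (x - z)) := by
        simp [map_prod]
      have hnat : R.natDegree * (μ + 1) ≤ (∏ z ∈ Z.erase x, (x - z)).natDegree := by
        rw [natDegree_prod _ _ hne]
        have := Finset.card_nsmul_le_sum (Z.erase x) (fun z => (x - z).natDegree) (μ + 1)
          (fun z hz => hsep x hx z (Finset.mem_of_mem_erase hz) (Finset.ne_of_mem_erase hz).symm)
        rwa [Finset.card_erase_of_mem hx, hcard, Nat.add_sub_cancel, smul_eq_mul] at this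
      rw [map_div₀, hprod, hv _ h0, hv _ (Finset.prod_ne_zero_iff.2 hne), hv _ hl0,
        ← WithZero.exp_sub, WithZero.exp_lt_exp]
      have := hval x hx
      have : R.natDegree * μ < R.natDegree * (μ + 1) :=
        Nat.mul_lt_mul_of_pos_left (Nat.lt_succ_self μ) (Nat.pos_of_ne_zero hd)
      omega
  exact lt_irrefl _ hlt

end Separation

/-! ### Distributivity of gcd over lcm -/

section LcmGcd

variable {α : Type*} [CommMonoidWithZero α] [NormalizedGCDMonoid α]

/-- With `g = gcd (gcd b x) (gcd b y)`, it suffices that `b g ∣ gcd b x * gcd b y`. This follows by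
expanding the product of gcds, as `b g` divides `x y`. -/
theorem dvd_lcm_gcd_gcd_of_dvd_lcm {b x y : α} (h : b ∣ lcm x y) :
    b ∣ lcm (gcd b x) (gcd b y) := by
  by_cases hb : b = 0
  · subst hb
    rcases (lcm_eq_zero_iff _ _).1 (zero_dvd_iff.1 h) with rfl | rfl <;> simp
  have hg : gcd (gcd b x) (gcd b y) ≠ 0 := fun h0 =>
    hb ((gcd_eq_zero_iff _ _).1 ((gcd_eq_zero_iff _ _).1 h0).1).1
  have hdvd : gcd (gcd b x) (gcd b y) ∣ gcd x y :=
    dvd_gcd ((gcd_dvd_left _ _).trans (gcd_dvd_right _ _))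
      ((gcd_dvd_right _ _).trans (gcd_dvd_right _ _))
  have hgb : gcd (gcd b x) (gcd b y) ∣ b := (gcd_dvd_left _ _).trans (gcd_dvd_left _ _)
  have h1 : b * gcd (gcd b x) (gcd b y) ∣ x * y :=
    (mul_dvd_mul h hdvd).trans ((mul_comm _ _).dvd.trans (gcd_mul_lcm x y).dvd)
  have hgx : gcd (gcd b x) (gcd b y) ∣ x := (gcd_dvd_left _ _).trans (gcd_dvd_right _ _)
  have hgy : gcd (gcd b x) (gcd b y) ∣ y := (gcd_dvd_right _ _).trans (gcd_dvd_right _ _)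
  have h2 : b * gcd (gcd b x) (gcd b y) ∣ gcd b x * gcd b y := by
    have h3 : b * gcd (gcd b x) (gcd b y) ∣ gcd (gcd b x * b) (gcd b x * y) := by
      refine dvd_gcd ((mul_comm _ _).dvd.trans (mul_dvd_mul (gcd_dvd_left _ _) dvd_rfl)) ?_
      have h4 : b * gcd (gcd b x) (gcd b y) ∣ gcd (b * y) (x * y) :=
        dvd_gcd (mul_dvd_mul dvd_rfl hgy) h1
      exact h4.trans (gcd_mul_right' y b x).dvd
    exact h3.trans (gcd_mul_left' (gcd b x) b y).dvd
  have h5 : gcd (gcd b x) (gcd b y) * b ∣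
      gcd (gcd b x) (gcd b y) * lcm (gcd b x) (gcd b y) :=
    (mul_comm _ _).dvd.trans (h2.trans (gcd_mul_lcm _ _).symm.dvd)
  exact (mul_dvd_mul_iff_left hg).1 h5

theorem dvd_finset_lcm_gcd_of_dvd_finset_lcm {ι : Type*} {s : Finset ι} {f : ι → α} {b : α}
    (h : b ∣ s.lcm f) : b ∣ s.lcm fun i => gcd b (f i) := by
  classical
  induction s using Finset.induction_on generalizing b with
  | empty => simpa using h
  | insert i s hi ih =>
    rw [Finset.lcm_insert] at h ⊢
    refine (dvd_lcm_gcd_gcd_of_dvd_lcm h).trans (lcm_dvd_lcm dvd_rfl ?_)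
    refine (ih (gcd_dvd_right b (s.lcm f))).trans (Finset.lcm_dvd fun j hj => ?_)
    exact (gcd_dvd_gcd (gcd_dvd_left _ _) dvd_rfl).trans
      (Finset.dvd_lcm (f := fun i => gcd b (f i)) hj)

end LcmGcd

/-! ### Finite sets of polynomials and the divisor bound -/

section Finite

variable {𝔽 : Type*} [Field 𝔽] [Fintype 𝔽]

theorem finite_degreeLT (m : ℕ) : (degreeLT 𝔽 m : Set 𝔽[X]).Finite :=
  have : Finite (degreeLT 𝔽 m) := Finite.of_equiv _ (degreeLTEquiv 𝔽 m).symm.toEquiv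
  Set.toFinite _

/-- The finite set of polynomials of degree less than `m` over a finite field. -/
noncomputable def degreeLTFinset (𝔽 : Type*) [Field 𝔽] [Fintype 𝔽] (m : ℕ) : Finset 𝔽[X] :=
  (finite_degreeLT (𝔽 := 𝔽) m).toFinset

theorem mem_degreeLTFinset {m : ℕ} {p : 𝔽[X]} : p ∈ degreeLTFinset 𝔽 m ↔ p.degree < m := by
  simp [degreeLTFinset, mem_degreeLT]

theorem card_degreeLTFinset (m : ℕ) : (degreeLTFinset 𝔽 m).card = Fintype.card 𝔽 ^ m := by
  rw [degreeLTFinset, ← Set.ncard_eq_toFinset_card _ (finite_degreeLT m), ← Nat.card_coe_set_eq]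
  exact (Nat.card_congr (degreeLTEquiv 𝔽 m).toEquiv).trans (by simp)

theorem finite_setOf_dvd {A : 𝔽[X]} (hA : A ≠ 0) : {D : 𝔽[X] | D ∣ A}.Finite := by
  refine (finite_degreeLT (A.natDegree + 1)).subset fun D hD => mem_degreeLT.2 ?_
  exact (degree_le_of_dvd hD hA).trans_lt
    (degree_le_natDegree.trans_lt (by exact_mod_cast Nat.lt_succ_self _))

open UniqueFactorizationMonoid in
/-- The divisor bound: a polynomial `A` has at most `C exp (η deg A)` divisors. -/
theorem exists_ncard_setOf_dvd_le (𝔽 : Type*) [Field 𝔽] [Fintype 𝔽] {η : ℝ} (hη : 0 < η) :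
    ∃ C : ℝ, 0 < C ∧ ∀ A : 𝔽[X], A ≠ 0 →
      ({D : 𝔽[X] | D ∣ A}.ncard : ℝ) ≤ C * Real.exp (η * A.natDegree) := by
  classical
  set L := ⌈1 / η⌉₊ with hL
  have hLη : 1 ≤ η * L := by
    have := Nat.le_ceil (1 / η)
    rw [div_le_iff₀ hη] at this
    linarith
  -- An irreducible factor of multiplicity `e` contributes `e + 1`. For degree at least `L ≥ 1 / η`
  -- this is at most `exp (η e deg)`; for the boundedly many of smaller degree the loss `c`
  -- suffices, since `c (η e + 1) ≥ e + 1`.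
  set c : ℝ := 1 + 1 / η with hc
  have hc1 : 1 ≤ c := by
    have : 0 < 1 / η := by positivity
    linarith
  refine ⟨Fintype.card 𝔽 * c ^ (degreeLTFinset 𝔽 L).card, by
    have : 0 < Fintype.card 𝔽 := Fintype.card_pos
    positivity, fun A hA => ?_⟩
  set M := normalizedFactors A with hM
  have hsub : {D : 𝔽[X] | D ∣ A} ⊆
      ((Finset.univ ×ˢ Finset.Iic M).image fun z : 𝔽 × Multiset 𝔽[X] => C z.1 * z.2.prod :
        Finset 𝔽[X]) := by
    intro D hD
    have hD0 : D ≠ 0 := ne_zero_of_dvd_ne_zero hA hD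
    obtain ⟨u, hu⟩ := prod_normalizedFactors hD0
    obtain ⟨a, -, ha⟩ := Polynomial.isUnit_iff.1 u.isUnit
    simp only [Finset.coe_image, Set.mem_image, Finset.mem_coe, Finset.mem_product,
      Finset.mem_univ, true_and, Finset.mem_Iic]
    exact ⟨(a, normalizedFactors D), (dvd_iff_normalizedFactors_le_normalizedFactors hD0 hA).1 hD,
      by rw [ha, mul_comm]; exact hu⟩
  have hcard : {D : 𝔽[X] | D ∣ A}.ncard ≤
      Fintype.card 𝔽 * ∏ i ∈ M.toFinset, (M.count i + 1) := by
    refine (Set.ncard_le_ncard hsub (Finset.finite_toSet _)).trans ?_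
    rw [Set.ncard_coe_finset]
    refine Finset.card_image_le.trans ?_
    rw [Finset.card_product, Finset.card_univ, Multiset.card_Iic]
  have hfac : ∀ i ∈ M.toFinset, ((M.count i + 1 : ℕ) : ℝ) ≤
      (if i.natDegree < L then c else 1) * Real.exp (η * (M.count i * i.natDegree : ℕ)) := by
    intro i hi
    have hirr : Irreducible i := irreducible_of_normalized_factor i (Multiset.mem_toFinset.1 hi)
    have hi1 : 1 ≤ i.natDegree := Irreducible.natDegree_pos hirr
    have he : (0 : ℝ) ≤ M.count i := Nat.cast_nonneg _
    push_cast
    split_ifs with h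
    · have h1 : (1 : ℝ) ≤ i.natDegree := by exact_mod_cast hi1
      have h2 : η * M.count i ≤ η * (M.count i * i.natDegree) := by
        gcongr
        nlinarith
      have h3 := Real.add_one_le_exp (η * (M.count i * i.natDegree : ℝ))
      have h4 : (M.count i : ℝ) + 1 ≤ c * (η * M.count i + 1) := by
        have : c * (η * M.count i + 1) =
          M.count i + 1 + η * M.count i + 1 / η := by rw [hc]; field_simp; ring
        have : 0 < 1 / η := by positivity
        have : 0 ≤ η * M.count i := by positivity
        linarith
      refine h4.trans ?_
      gcongr
      linarith
    · have h1 : (L : ℝ) ≤ i.natDegree := by exact_mod_cast not_lt.1 h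
      rw [one_mul]
      refine (Real.add_one_le_exp _).trans (Real.exp_le_exp.2 ?_)
      have h2 : 1 ≤ η * i.natDegree := hLη.trans (by gcongr)
      calc (M.count i : ℝ) = M.count i * 1 := (mul_one _).symm
        _ ≤ M.count i * (η * i.natDegree) := by gcongr
        _ = _ := by ring
  have hdeg : ∑ i ∈ M.toFinset, M.count i * i.natDegree = A.natDegree := by
    have h1 : (M.map natDegree).sum = A.natDegree := by
      rw [← natDegree_multiset_prod _ (zero_notMem_normalizedFactors A)]
      exact natDegree_eq_of_degree_eq (degree_eq_degree_of_associated (prod_normalizedFactors hA))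
    rw [← h1, Finset.sum_multiset_map_count]
    simp
  calc ({D : 𝔽[X] | D ∣ A}.ncard : ℝ)
      ≤ Fintype.card 𝔽 * ∏ i ∈ M.toFinset, ((M.count i + 1 : ℕ) : ℝ) := by exact_mod_cast hcard
    _ ≤ Fintype.card 𝔽 * ∏ i ∈ M.toFinset, ((if i.natDegree < L then c else 1) *
          Real.exp (η * (M.count i * i.natDegree : ℕ))) := by
        gcongr with i hi
        exact hfac i hi
    _ = Fintype.card 𝔽 * (c ^ (M.toFinset.filter fun i => i.natDegree < L).card *
          Real.exp (η * A.natDegree)) := by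
        rw [Finset.prod_mul_distrib, ← Real.exp_sum, ← Finset.mul_sum, ← Nat.cast_sum, hdeg,
          Finset.prod_ite, Finset.prod_const, Finset.prod_const_one, mul_one]
    _ ≤ Fintype.card 𝔽 * (c ^ (degreeLTFinset 𝔽 L).card * Real.exp (η * A.natDegree)) := by
        gcongr
        intro i hi
        rw [mem_degreeLTFinset]
        exact degree_le_natDegree.trans_lt (by exact_mod_cast (Finset.mem_filter.1 hi).2)
    _ = _ := by ring

end Finite

/-! ### Weighted counting of tuples -/

section Counting

open scoped Classical

variable {𝔽 : Type*} [Field 𝔽]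

/-- Sort `Z` by the coefficients above `T^μ`. Representatives of distinct classes are separated, so
there are at most `D` classes; within one, differences are multiples of `Δ` of degree less than `min
(μ + 1) m`. -/
theorem card_le_mul_pow_of_separated_card_le [Fintype 𝔽] {m μ D : ℕ} {Z : Finset 𝔽[X]}
    {Δ : 𝔽[X]} (hΔ : Δ ≠ 0)
    (hZm : ∀ x ∈ Z, x.degree < m) (hZ : ∀ x ∈ Z, ∀ y ∈ Z, Δ ∣ x - y)
    (hsep : ∀ Z' ⊆ Z, (∀ x ∈ Z', ∀ y ∈ Z', x ≠ y → μ < (x - y).natDegree) → Z'.card ≤ D) :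
    Z.card ≤ D * Fintype.card 𝔽 ^ (min (μ + 1) m - Δ.natDegree) := by
  let φ : 𝔽[X] → ℕ → 𝔽 := fun x i => if μ < i then x.coeff i else 0
  have hφ : ∀ x y, φ x = φ y ↔ (x - y).natDegree ≤ μ := by
    intro x y
    rw [natDegree_le_iff_coeff_eq_zero, funext_iff]
    refine forall_congr' fun i => ?_
    by_cases h : μ < i
    · simp [φ, h, sub_eq_zero]
    · simp [φ, h]
  have himg : (Z.image φ).card ≤ D := by
    obtain ⟨Z', hZ'Z, hinj, himg⟩ := Finset.exists_subset_injOn_image_eq_of_surjOn (f := φ)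
      (Z : Set 𝔽[X]) (Z.image φ) (by rw [Finset.coe_image]; exact Set.surjOn_image _ _)
    rw [← himg, Finset.card_image_of_injOn hinj]
    refine hsep Z' hZ'Z fun x hx y hy hxy => ?_
    by_contra h
    exact hxy (hinj hx hy ((hφ x y).2 (not_lt.1 h)))
  have hfib : ∀ a ∈ Z.image φ, (Z.filter fun x => φ x = a).card ≤
      Fintype.card 𝔽 ^ (min (μ + 1) m - Δ.natDegree) := by
    intro a ha
    obtain ⟨y, hy, rfl⟩ := Finset.mem_image.1 ha
    have hc : ∀ x, ∃ c, x ∈ Z → x - y = Δ * c := by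
      intro x
      by_cases hx : x ∈ Z
      · obtain ⟨c, hc⟩ := hZ x hx y hy
        exact ⟨c, fun _ => hc⟩
      · exact ⟨0, fun h => absurd h hx⟩
    choose g hg using hc
    rw [← card_degreeLTFinset]
    refine Finset.card_le_card_of_injOn g ?_ ?_
    · intro x hx
      obtain ⟨hxZ, hxy⟩ := Finset.mem_filter.1 hx
      rw [Finset.mem_coe, mem_degreeLTFinset]
      by_cases h0 : g x = 0
      · rw [h0, degree_zero]
        exact WithBot.bot_lt_coe _
      · have h1 := (hφ x y).1 hxy
        have hne : x - y ≠ 0 := by rw [hg x hxZ]; exact mul_ne_zero hΔ h0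
        have h2 : (x - y).natDegree < m := by
          rw [natDegree_lt_iff_degree_lt hne]
          exact (degree_sub_le _ _).trans_lt (max_lt (hZm x hxZ) (hZm y hy))
        rw [hg x hxZ, natDegree_mul hΔ h0] at h1 h2
        rw [← natDegree_lt_iff_degree_lt h0]
        omega
    · intro x hx z hz hxz
      have hx' := hg x (Finset.mem_filter.1 hx).1
      have hz' := hg z (Finset.mem_filter.1 hz).1
      rw [hxz, ← hz'] at hx'
      exact sub_left_injective hx'
  calc Z.card ≤ _ := Finset.card_le_mul_card_image Z _ hfib
    _ ≤ Fintype.card 𝔽 ^ (min (μ + 1) m - Δ.natDegree) * D := Nat.mul_le_mul_left _ himg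
    _ = _ := mul_comm _ _

/-- The least common multiple of the common divisors of `B y` with the differences `s - y`,
for `s ∈ Y`. -/
noncomputable def overlap (B : 𝔽[X] → 𝔽[X]) (Y : Finset 𝔽[X])
    (y : 𝔽[X]) : 𝔽[X] :=
  Y.lcm fun s => gcd (B y) (s - y)

theorem overlap_dvd (B : 𝔽[X] → 𝔽[X]) (Y : Finset 𝔽[X])
    (y : 𝔽[X]) : overlap B Y y ∣ B y :=
  Finset.lcm_dvd fun _ _ => gcd_dvd_left _ _

/-- The exponent of the number of those `y` with a given degree of `B y` that have given
common divisors of `B y` with the differences `s - y`, for `s ∈ Y`. -/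
noncomputable def excess (m : ℕ) (B : 𝔽[X] → 𝔽[X])
    (Y : Finset 𝔽[X]) (y : 𝔽[X]) : ℕ :=
  min ((B y).natDegree + 1) m - (overlap B Y y).natDegree

/-- Group the `y` by `deg B(y)` and the divisors `gcd(B(y), s - y)`. The excess is constant on a
group and the weights of a group sum to at most `D`, so the total is at most `D` times the number of
groups. -/
theorem sum_inv_pow_excess_le [Fintype 𝔽] {m n N D : ℕ} {T : ℝ}
    (hT : 1 ≤ T) {A B : 𝔽[X] → 𝔽[X]} {I Y : Finset 𝔽[X]} (hI : ∀ y ∈ I, y.degree < m)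
    (hA : ∀ y ∈ I, A y ≠ 0) (hAN : ∀ y ∈ I, (A y).natDegree ≤ N)
    (hT' : ∀ y ∈ I, ({d | d ∣ A y}.ncard : ℝ) ≤ T) (hBA : ∀ y, B y ∣ A y)
    (hcong : ∀ y z, y - z ∣ A y - A z)
    (hsep : ∀ μ, ∀ Z ⊆ I, (∀ x ∈ Z, (B x).natDegree ≤ μ) →
      (∀ x ∈ Z, ∀ y ∈ Z, x ≠ y → μ < (x - y).natDegree) → Z.card ≤ D)
    (hY : Y ⊆ I) (hYn : Y.card ≤ n) :
    ∑ y ∈ I, ((Fintype.card 𝔽 : ℝ) ^ excess m B Y y)⁻¹ ≤ (N + 1) * T ^ n * D := by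
  have hq : (0 : ℝ) < Fintype.card 𝔽 := by exact_mod_cast Fintype.card_pos
  have hfin : ∀ s : Y, {d | d ∣ A s}.Finite := fun s => finite_setOf_dvd (hA s (hY s.2))
  let f : 𝔽[X] → ℕ × (Y → 𝔽[X]) := fun y => ((B y).natDegree, fun s => gcd (B y) (s - y))
  let U : Finset (ℕ × (Y → 𝔽[X])) :=
    Finset.range (N + 1) ×ˢ Fintype.piFinset fun s : Y => (hfin s).toFinset
  have hB0 : ∀ y ∈ I, B y ≠ 0 := fun y hy => ne_zero_of_dvd_ne_zero (hA y hy) (hBA y)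
  have hfU : ∀ y ∈ I, f y ∈ U := by
    intro y hy
    refine Finset.mem_product.2 ⟨Finset.mem_range.2 (Nat.lt_succ_of_le
      ((natDegree_le_of_dvd (hBA y) (hA y hy)).trans (hAN y hy))), Fintype.mem_piFinset.2 fun s => ?_⟩
    rw [Set.Finite.mem_toFinset]
    -- The gcd divides `A s`, which does not depend on `y`; this is what keeps the number of groups
    -- small.
    have h1 : gcd (B y) (s - y) ∣ A y := (gcd_dvd_left _ _).trans (hBA y)
    have h2 : gcd (B y) (s - y) ∣ A s - A y := (gcd_dvd_right _ _).trans (hcong s y)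
    exact (dvd_sub_left h1).1 h2
  have hUcard : (U.card : ℝ) ≤ (N + 1) * T ^ n := by
    rw [Finset.card_product, Finset.card_range, Fintype.card_piFinset]
    push_cast
    gcongr
    calc ∏ s : Y, ((hfin s).toFinset.card : ℝ) ≤ ∏ _s : Y, T := by
          gcongr with s
          rw [← Set.ncard_eq_toFinset_card _ (hfin s)]
          exact hT' s (hY s.2)
      _ = T ^ Y.card := by simp
      _ ≤ T ^ n := pow_le_pow_right₀ hT hYn
  have hfib : ∀ u ∈ U, ∑ y ∈ I with f y = u, ((Fintype.card 𝔽 : ℝ) ^ excess m B Y y)⁻¹ ≤ D := by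
    intro u _
    rcases (I.filter fun y => f y = u).eq_empty_or_nonempty with he | ⟨y, hy⟩
    · rw [he]; simp
    obtain ⟨hyI, hyu⟩ := Finset.mem_filter.1 hy
    have hsame : ∀ x ∈ I.filter fun y => f y = u,
        (B x).natDegree = (B y).natDegree ∧ ∀ s ∈ Y, gcd (B x) (s - x) = gcd (B y) (s - y) := by
      intro x hx
      have hxy : f x = f y := (Finset.mem_filter.1 hx).2.trans hyu.symm
      exact ⟨congrArg Prod.fst hxy, fun s hs => congrFun (congrArg Prod.snd hxy) ⟨s, hs⟩⟩
    have hover : ∀ x ∈ I.filter fun y => f y = u, overlap B Y x = overlap B Y y := fun x hx =>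
      Finset.lcm_congr rfl (hsame x hx).2
    have hexc : ∀ x ∈ I.filter fun y => f y = u, excess m B Y x = excess m B Y y := fun x hx => by
      rw [excess, excess, hover x hx, (hsame x hx).1]
    rw [Finset.sum_congr rfl fun x hx => by rw [hexc x hx], Finset.sum_const, nsmul_eq_mul,
      ← div_eq_mul_inv, div_le_iff₀ (by positivity)]
    have := card_le_mul_pow_of_separated_card_le (m := m) (μ := (B y).natDegree) (D := D)
      (Z := I.filter fun y => f y = u)
      (ne_zero_of_dvd_ne_zero (hB0 y hyI) (overlap_dvd B Y y))
      (fun x hx => hI x (Finset.mem_filter.1 hx).1)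
      (fun x hx z hz => Finset.lcm_dvd fun s hs => by
        have h1 : gcd (B y) (s - y) ∣ s - x := by
          rw [← (hsame x hx).2 s hs]; exact gcd_dvd_right _ _
        have h2 : gcd (B y) (s - y) ∣ s - z := by
          rw [← (hsame z hz).2 s hs]; exact gcd_dvd_right _ _
        simpa using dvd_sub h2 h1)
      (fun Z' hZ' h => hsep _ Z' (hZ'.trans (Finset.filter_subset _ _))
        (fun x hx => (hsame x (hZ' hx)).1.le) h)
    exact_mod_cast this
  calc ∑ y ∈ I, ((Fintype.card 𝔽 : ℝ) ^ excess m B Y y)⁻¹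
      = ∑ u ∈ U, ∑ y ∈ I with f y = u, ((Fintype.card 𝔽 : ℝ) ^ excess m B Y y)⁻¹ :=
        (Finset.sum_fiberwise_of_maps_to hfU _).symm
    _ ≤ ∑ _u ∈ U, (D : ℝ) := Finset.sum_le_sum hfib
    _ = U.card * D := by simp
    _ ≤ _ := by gcongr

/-- Sum over coordinate `0` first: it enters only its own factor, whose set `Y` consists of all the
other coordinates. What remains is the same sum for the tail. -/
theorem sum_piFinset_prod_le_pow {α : Type*} [DecidableEq α] {I : Finset α}
    {w : Finset α → α → ℝ} {K : ℝ} {N : ℕ} (hw : ∀ Y y, 0 ≤ w Y y)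
    (hK : ∀ Y ⊆ I, Y.card ≤ N → ∑ y ∈ I, w Y y ≤ K) (n : ℕ) (hn : n ≤ N) :
    ∑ y ∈ Fintype.piFinset fun _ : Fin n => I,
      ∏ t, w ((Finset.Ioi t).image y) (y t) ≤ K ^ n := by
  induction n with
  | zero => simp
  | succ n ih =>
    have hK0 : 0 ≤ K := (Finset.sum_nonneg fun y _ => hw ∅ y).trans
      (hK ∅ (Finset.empty_subset _) (by simp))
    have hbij : ∑ y ∈ Fintype.piFinset fun _ : Fin (n + 1) => I,
        ∏ t, w ((Finset.Ioi t).image y) (y t) =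
        ∑ z ∈ Fintype.piFinset (fun _ : Fin n => I), ∑ x ∈ I,
          w (Finset.univ.image z) x * ∏ t, w ((Finset.Ioi t).image z) (z t) := by
      rw [← Finset.sum_product']
      refine Finset.sum_nbij' (fun y : Fin (n + 1) → α => (Fin.tail y, y 0))
        (fun p : (Fin n → α) × α => (Fin.cons p.2 p.1 : Fin (n + 1) → α)) ?_ ?_ ?_ ?_ ?_
      · intro y hy
        rw [Fintype.mem_piFinset] at hy
        exact Finset.mem_product.2 ⟨Fintype.mem_piFinset.2 fun t => hy t.succ, hy 0⟩
      · intro p hp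
        obtain ⟨h1, h2⟩ := Finset.mem_product.1 hp
        rw [Fintype.mem_piFinset] at h1 ⊢
        intro t
        refine Fin.cases ?_ (fun t => ?_) t
        · simpa using h2
        · simpa using h1 t
      · intro y _
        exact Fin.cons_self_tail y
      · intro p _
        simp
      · intro y _
        rw [Fin.prod_univ_succ]
        have h0 : (Finset.Ioi (0 : Fin (n + 1))).image y = Finset.univ.image (Fin.tail y) := by
          ext x
          simp [Fin.exists_fin_succ, Fin.tail]
        have h1 : ∀ t : Fin n,
            (Finset.Ioi t.succ).image y = (Finset.Ioi t).image (Fin.tail y) := fun t => by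
          ext x
          simp [Fin.exists_fin_succ, Fin.tail]
        simp only [h0, h1]
        rfl
    rw [hbij]
    calc _ ≤ ∑ z ∈ Fintype.piFinset (fun _ : Fin n => I),
          K * ∏ t, w ((Finset.Ioi t).image z) (z t) := by
          refine Finset.sum_le_sum fun z hz => ?_
          rw [← Finset.sum_mul]
          refine mul_le_mul_of_nonneg_right (hK _ ?_ ?_) (Finset.prod_nonneg fun _ _ => hw _ _)
          · intro x hx
            obtain ⟨t, -, rfl⟩ := Finset.mem_image.1 hx
            exact Fintype.mem_piFinset.1 hz t
          · refine Finset.card_image_le.trans ?_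
            rw [Finset.card_univ, Fintype.card_fin]
            omega
      _ ≤ K ^ (n + 1) := by
          rw [← Finset.mul_sum, pow_succ']
          exact mul_le_mul_of_nonneg_left (ih (by omega)) hK0

/-- `B(y_t)` divides the product of its two overlaps, so their degrees sum to at least `deg B(y_t)`.
Bounding one minimum by `deg B(y_t) + 1` and the other by `m` gives the claim. -/
theorem excess_add_excess_le [DecidableEq 𝔽[X]] {n m : ℕ}
    {B : 𝔽[X] → 𝔽[X]}
    {y : Fin n → 𝔽[X]} {t : Fin n} (hB : B (y t) ≠ 0)
    (h : ∀ L, (∀ j ≠ t, y j - y t ∣ L) → B (y t) ∣ L) :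
    excess m B ((Finset.Ioi t).image y) (y t) + excess m B ((Finset.Iio t).image y) (y t) ≤
      m + 1 := by
  set Y₁ := (Finset.Ioi t).image y
  set Y₂ := (Finset.Iio t).image y
  have h1 : B (y t) ∣ (Y₁ ∪ Y₂).lcm fun s => s - y t := by
    refine h _ fun j hj => Finset.dvd_lcm (f := fun s => s - y t) ?_
    rcases lt_or_gt_of_ne hj with hj | hj
    · exact Finset.mem_union_right _ (Finset.mem_image_of_mem _ (Finset.mem_Iio.2 hj))
    · exact Finset.mem_union_left _ (Finset.mem_image_of_mem _ (Finset.mem_Ioi.2 hj))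
  have h2 := dvd_finset_lcm_gcd_of_dvd_finset_lcm h1
  rw [Finset.lcm_union] at h2
  have h3 : B (y t) ∣ overlap B Y₁ (y t) * overlap B Y₂ (y t) :=
    h2.trans (lcm_dvd (dvd_mul_right _ _) (dvd_mul_left _ _))
  have h4 : ∀ Y, overlap B Y (y t) ≠ 0 := fun Y => ne_zero_of_dvd_ne_zero hB (overlap_dvd B Y _)
  have h5 := natDegree_le_of_dvd h3 (mul_ne_zero (h4 _) (h4 _))
  rw [natDegree_mul (h4 _) (h4 _)] at h5
  unfold excess
  omega

theorem card_le_of_sum_inv_pow_le {α : Type*} [DecidableEq α] {e : Finset α → α → ℕ} {n k M : ℕ} {q K : ℝ}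
    (hq : 1 ≤ q) (hn : n = k + k) {I : Finset α}
    (hK : ∀ Y ⊆ I, Y.card ≤ n → ∑ y ∈ I, (q ^ e Y y)⁻¹ ≤ K)
    {S : Finset (Fin n → α)} (hSI : ∀ y ∈ S, ∀ t, y t ∈ I)
    (hS : ∀ y ∈ S, ∀ t, e ((Finset.Ioi t).image y) (y t) + e ((Finset.Iio t).image y) (y t) ≤ M) :
    (S.card : ℝ) ≤ 2 * q ^ (k * M) * K ^ n := by
  have hq0 : 0 < q := by linarith
  let W : (Fin n → α) → ℝ := fun y =>
    ∏ t, (q ^ e ((Finset.Ioi t).image y) (y t))⁻¹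
  have hW0 : ∀ y, 0 ≤ W y := fun y => Finset.prod_nonneg fun _ _ => by positivity
  have hW : ∀ y, W y = (q ^ ∑ t, e ((Finset.Ioi t).image y) (y t))⁻¹ := fun y => by
    rw [← Finset.prod_pow_eq_pow_sum, ← Finset.prod_inv_distrib]
  have hWrev : ∀ y : Fin n → α,
      W (y ∘ Fin.rev) = (q ^ ∑ t, e ((Finset.Iio t).image y) (y t))⁻¹ := fun y => by
    rw [hW]
    congr 2
    refine Fintype.sum_equiv Fin.revPerm _ _ fun t => ?_
    have : (Finset.Ioi t).image (y ∘ Fin.rev) = (Finset.Iio (Fin.rev t)).image y := by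
      rw [← Finset.image_image]
      congr 1
      ext s
      simp only [Finset.mem_image, Finset.mem_Ioi, Finset.mem_Iio]
      constructor
      · rintro ⟨a, ha, rfl⟩
        exact Fin.rev_lt_rev.2 ha
      · intro h
        exact ⟨Fin.rev s, by rw [← Fin.rev_lt_rev, Fin.rev_rev]; exact h, Fin.rev_rev s⟩
    rw [this, Function.comp_apply, Fin.revPerm_apply]
  set P := Fintype.piFinset fun _ : Fin n => I with hP
  have hSP : S ⊆ P := fun y hy => Fintype.mem_piFinset.2 (hSI y hy)
  have hsum : ∑ y ∈ P, W y ≤ K ^ n :=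
    sum_piFinset_prod_le_pow (w := fun Y y => (q ^ e Y y)⁻¹)
      (fun _ _ => by positivity) hK _ le_rfl
  have hsumrev : ∑ y ∈ P, W (y ∘ Fin.rev) = ∑ y ∈ P, W y := by
    refine Finset.sum_nbij' (fun y => y ∘ Fin.rev) (fun y => y ∘ Fin.rev) ?_ ?_ ?_ ?_ ?_
    · exact fun y hy => Fintype.mem_piFinset.2 fun t => Fintype.mem_piFinset.1 hy _
    · exact fun y hy => Fintype.mem_piFinset.2 fun t => Fintype.mem_piFinset.1 hy _
    · exact fun y _ => funext fun t => congrArg y (Fin.rev_rev t)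
    · exact fun y _ => funext fun t => congrArg y (Fin.rev_rev t)
    · exact fun y _ => rfl
  -- The two total exponents sum to at most `2kM`, so one of them is at most `kM`.
  have hone : ∀ y ∈ S, 1 ≤ q ^ (k * M) * (W y + W (y ∘ Fin.rev)) := by
    intro y hy
    have hle : ∑ t, e ((Finset.Ioi t).image y) (y t) +
        ∑ t, e ((Finset.Iio t).image y) (y t) ≤ (k + k) * M := by
      rw [← Finset.sum_add_distrib]
      refine (Finset.sum_le_card_nsmul _ _ M fun t _ =>
        hS y hy t).trans ?_
      simp [hn]
    have hinv : ∀ e ≤ k * M, 1 ≤ q ^ (k * M) * (q ^ e)⁻¹ := fun e he => by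
      rw [← div_eq_mul_inv, one_le_div (by positivity)]
      exact pow_le_pow_right₀ hq he
    have hp : 0 ≤ q ^ (k * M) := by positivity
    rw [mul_add]
    rcases le_total (∑ t, e ((Finset.Ioi t).image y) (y t)) (k * M) with h | h
    · have h1 := hinv _ h
      rw [← hW] at h1
      have := mul_nonneg hp (hW0 (y ∘ Fin.rev))
      linarith
    · have h1 := hinv (∑ t, e ((Finset.Iio t).image y) (y t)) (by
        rw [add_mul] at hle; omega)
      rw [← hWrev] at h1
      have := mul_nonneg hp (hW0 y)
      linarith
  calc (S.card : ℝ) = ∑ _y ∈ S, (1 : ℝ) := by simp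
    _ ≤ ∑ y ∈ S, q ^ (k * M) * (W y + W (y ∘ Fin.rev)) := Finset.sum_le_sum hone
    _ ≤ ∑ y ∈ P, q ^ (k * M) * (W y + W (y ∘ Fin.rev)) :=
        Finset.sum_le_sum_of_subset_of_nonneg hSP fun y _ _ =>
          mul_nonneg (by positivity) (add_nonneg (hW0 _) (hW0 _))
    _ = q ^ (k * M) * (∑ y ∈ P, W y + ∑ y ∈ P, W y) := by
        rw [← Finset.mul_sum, Finset.sum_add_distrib, hsumrev]
    _ ≤ q ^ (k * M) * (K ^ n + K ^ n) := by gcongr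
    _ = _ := by ring

end Counting

/-! ### The weighted degree -/

section Weight

variable {𝔽 : Type*} [Field 𝔽]

/-- The substitution `S ↦ S T ^ m`, followed by the exchange of the two variables. The degree of
the result is the degree for which `T` has weight `1` and `S` has weight `m`. -/
noncomputable def weightSubst (m : ℕ) : 𝔽[X][X] →+* 𝔽[X][X] :=
  eval₂RingHom (mapRingHom C) (C X * X ^ m)

theorem coeff_coeff_weightSubst (m : ℕ) (P : 𝔽[X][X]) (i j : ℕ) :
    ((weightSubst m P).coeff i).coeff j =
      if j * m ≤ i then (P.coeff j).coeff (i - j * m) else 0 := by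
  induction P using Polynomial.induction_on' with
  | add p q hp hq =>
    rw [map_add, coeff_add, coeff_add, hp, hq]
    split_ifs <;> simp
  | monomial n p =>
    have h : weightSubst m (monomial n p) = p.map C * C (X ^ n) * X ^ (n * m) := by
      simp only [weightSubst, coe_eval₂RingHom, eval₂_monomial, coe_mapRingHom, mul_pow, ← C_pow,
        ← pow_mul, mul_assoc, mul_comm m n]
    rw [h, coeff_mul_X_pow', coeff_monomial]
    by_cases hj : n = j
    · subst hj
      rw [if_pos rfl]
      split_ifs with h1
      · rw [coeff_mul_C, coeff_map, coeff_C_mul, coeff_X_pow_self, mul_one]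
      · simp
    · rw [if_neg hj, coeff_zero, ite_self]
      split_ifs with h1
      · rw [coeff_mul_C, coeff_map, coeff_C_mul, coeff_X_pow, if_neg (Ne.symm hj), mul_zero]
      · simp

theorem natDegree_weightSubst_le_iff {m W : ℕ} {P : 𝔽[X][X]} :
    (weightSubst m P).natDegree ≤ W ↔
      ∀ j, P.coeff j ≠ 0 → (P.coeff j).natDegree + j * m ≤ W := by
  constructor
  · intro h j hj
    refine le_trans (le_natDegree_of_ne_zero fun h0 => ?_) h
    have h1 := coeff_coeff_weightSubst m P ((P.coeff j).natDegree + j * m) j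
    rw [h0, if_pos (Nat.le_add_left _ _), Nat.add_sub_cancel, coeff_zero, coeff_natDegree] at h1
    exact hj (leadingCoeff_eq_zero.1 h1.symm)
  · intro h
    rw [natDegree_le_iff_coeff_eq_zero]
    intro i hi
    ext j
    rw [coeff_coeff_weightSubst, coeff_zero]
    split_ifs with hj
    · by_cases h0 : P.coeff j = 0
      · simp [h0]
      · have := h j h0
        exact coeff_eq_zero_of_natDegree_lt (by omega)
    · rfl

theorem weightSubst_injective (m : ℕ) : Function.Injective (weightSubst (𝔽 := 𝔽) m) := by
  rw [injective_iff_map_eq_zero]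
  intro P hP
  ext j i
  have h := coeff_coeff_weightSubst m P (i + j * m) j
  rw [hP, if_pos (Nat.le_add_left _ _), Nat.add_sub_cancel] at h
  simpa using h.symm

/-- The weight is additive on products, because the substitution is an injective ring homomorphism
into a domain. -/
theorem natDegree_weightSubst_le_of_dvd {m : ℕ} {P Q : 𝔽[X][X]} (h : P ∣ Q) (hQ : Q ≠ 0) :
    (weightSubst m P).natDegree ≤ (weightSubst m Q).natDegree := by
  obtain ⟨c, rfl⟩ := h
  have h0 : ∀ R : 𝔽[X][X], R ≠ 0 → weightSubst m R ≠ 0 := fun R hR h0 =>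
    hR (weightSubst_injective m (by rw [h0, map_zero]))
  rw [map_mul, natDegree_mul (h0 _ (left_ne_zero_of_mul hQ)) (h0 _ (right_ne_zero_of_mul hQ))]
  exact Nat.le_add_right _ _

theorem natDegree_le_of_natDegree_weightSubst_le {m d : ℕ} (hm : 1 ≤ m) {P : 𝔽[X][X]}
    (h : (weightSubst m P).natDegree ≤ d * m) : P.natDegree ≤ d := by
  by_cases hP : P = 0
  · simp [hP]
  · have := natDegree_weightSubst_le_iff.1 h P.natDegree (by simpa using hP)
    exact Nat.le_of_mul_le_mul_right (le_trans (Nat.le_add_left _ _) this) hm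

theorem natDegree_eval_le_of_natDegree_weightSubst_le {m W : ℕ} {P : 𝔽[X][X]} {y : 𝔽[X]}
    (h : (weightSubst m P).natDegree ≤ W) (hy : y.natDegree ≤ m) :
    (P.eval y).natDegree ≤ W := by
  rw [eval_eq_sum_range]
  refine natDegree_sum_le_of_forall_le _ _ fun j _ => ?_
  by_cases h0 : P.coeff j = 0
  · simp [h0]
  · have h1 := natDegree_weightSubst_le_iff.1 h j h0
    have h2 : (y ^ j).natDegree ≤ j * m := natDegree_pow_le.trans (Nat.mul_le_mul_left _ hy)
    exact natDegree_mul_le.trans (by omega)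

theorem natDegree_weightSubst_reciprocalNumerator_le {m n : ℕ} {ε y : Fin n → 𝔽[X]}
    (hε : ∀ i, (ε i).natDegree = 0) (hy : ∀ i, (y i).natDegree ≤ m) :
    (weightSubst m (reciprocalNumerator ε y)).natDegree ≤ (n - 1) * m := by
  have hC : ∀ a : 𝔽[X], weightSubst m (C a) = a.map C := fun a => by simp [weightSubst]
  have hX : weightSubst m (X : 𝔽[X][X]) = C X * X ^ m := by simp [weightSubst]
  rw [reciprocalNumerator, map_sum]
  refine natDegree_sum_le_of_forall_le _ _ fun i _ => ?_
  rw [map_mul, map_prod, hC]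
  refine natDegree_mul_le.trans ?_
  rw [natDegree_map, hε, zero_add]
  refine (natDegree_prod_le _ _).trans ?_
  refine (Finset.sum_le_card_nsmul _ _ m fun j _ => ?_).trans ?_
  · rw [map_add, hC, hX]
    refine natDegree_add_le_of_degree_le (natDegree_C_mul_X_pow_le _ _) ?_
    rw [natDegree_map]
    exact hy j
  · simp [Finset.card_erase_of_mem]

end Weight

/-! ### Resultants and the common factor -/

section Resultant

variable {𝔽 : Type*} [Field 𝔽]

theorem natDegree_det_add_sum_le {N : ℕ} {M : Matrix (Fin N) (Fin N) 𝔽[X]} {a b : Fin N → ℕ}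
    (h : ∀ i j, M i j ≠ 0 → (M i j).natDegree + a i ≤ b j) (hM : M.det ≠ 0) :
    M.det.natDegree + ∑ i, a i ≤ ∑ j, b j := by
  rw [Matrix.det_apply] at hM ⊢
  have hterm : ∀ σ : Equiv.Perm (Fin N), ∏ i, M (σ i) i ≠ 0 →
      (∏ i, M (σ i) i).natDegree + ∑ i, a i ≤ ∑ j, b j := by
    intro σ hσ
    have hne := Finset.prod_ne_zero_iff.1 hσ
    rw [natDegree_prod _ _ hne, ← Equiv.sum_comp σ a, ← Finset.sum_add_distrib]
    exact Finset.sum_le_sum fun i hi => h _ _ (hne i hi)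
  -- Needed for the truncated subtraction below; some permutation contributes a nonzero term because
  -- the determinant is nonzero.
  have hle : ∑ i, a i ≤ ∑ j, b j := by
    obtain ⟨σ, -, hσ⟩ := Finset.exists_ne_zero_of_sum_ne_zero hM
    exact (Nat.le_add_left _ _).trans (hterm σ fun h0 => hσ (by rw [h0, smul_zero]))
  have hdeg : (∑ σ : Equiv.Perm (Fin N), Equiv.Perm.sign σ • ∏ i, M (σ i) i).natDegree ≤
      ∑ j, b j - ∑ i, a i := by
    refine natDegree_sum_le_of_forall_le _ _ fun σ _ => (natDegree_smul_le _ _).trans ?_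
    by_cases h0 : ∏ i, M (σ i) i = 0
    · simp [h0]
    · have := hterm σ h0
      omega
  omega

/-- The Sylvester matrix is homogeneous for the weight: give row `i` the weight `i m`, and column
`j` of each block the weight `W + j m` or `V + j m`. -/
theorem natDegree_resultant_add_le {m V W : ℕ} {f g : 𝔽[X][X]}
    (hf : (weightSubst m f).natDegree ≤ V) (hg : (weightSubst m g).natDegree ≤ W)
    (h : f.resultant g ≠ 0) :
    (f.resultant g).natDegree + f.natDegree * g.natDegree * m ≤
      f.natDegree * W + g.natDegree * V := by
  rw [natDegree_weightSubst_le_iff] at hf hg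
  set d := f.natDegree with hd
  set e := g.natDegree with he
  have key := natDegree_det_add_sum_le (M := sylvester f g d e) (a := fun i => i * m)
    (b := fun j => Fin.addCases (fun j : Fin d => W + j * m) (fun j : Fin e => V + j * m) j)
    (by
      intro i j
      induction j using Fin.addCases with
      | left j =>
        simp only [sylvester, Matrix.of_apply, Fin.addCases_left]
        split_ifs with hij
        · intro h0
          have := hg _ h0
          obtain ⟨c, hc⟩ := Nat.exists_eq_add_of_le hij.1
          rw [hc, Nat.add_sub_cancel_left] at this ⊢
          rw [add_mul]
          omega
        · simp
      | right j =>
        simp only [sylvester, Matrix.of_apply, Fin.addCases_right]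
        split_ifs with hij
        · intro h0
          have := hf _ h0
          obtain ⟨c, hc⟩ := Nat.exists_eq_add_of_le hij.1
          rw [hc, Nat.add_sub_cancel_left] at this ⊢
          rw [add_mul]
          omega
        · simp) h
  rw [Fin.sum_univ_add, Fin.sum_univ_add] at key
  simp only [Fin.val_castAdd, Fin.val_natAdd, Fin.addCases_left, Fin.addCases_right, add_mul,
    Finset.sum_add_distrib, Finset.sum_const, Finset.card_univ, Fintype.card_fin,
    smul_eq_mul] at key
  have h1 : e * (d * m) = d * e * m := by ring
  change (resultant f g d e).natDegree + _ ≤ _ at key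
  omega

/-- By Gauss's lemma irreducibility and non-divisibility persist over the fraction field, where they
amount to coprimality. -/
theorem resultant_ne_zero_of_irreducible_of_not_dvd {R Q : 𝔽[X][X]} (hR : Irreducible R)
    (hd : R.natDegree ≠ 0) (h : ¬ R ∣ Q) : R.resultant Q ≠ 0 := by
  classical
  let a := algebraMap 𝔽[X] (RatFunc 𝔽)
  have hinj : Function.Injective a := RatFunc.algebraMap_injective 𝔽
  have hprim : R.IsPrimitive := hR.isPrimitive hd
  have hirr : Irreducible (R.map a) :=
    (hprim.irreducible_iff_irreducible_map_fraction_map (K := RatFunc 𝔽)).1 hR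
  have hcop : IsCoprime (R.map a) (Q.map a) := by
    refine (EuclideanDomain.dvd_or_coprime _ _ hirr).resolve_left fun hdvd => h ?_
    exact (hprim.dvd_iff_fraction_map_dvd_fraction_map (RatFunc 𝔽)).2 hdvd
  have hne := resultant_ne_zero _ _ hcop
  rw [natDegree_map_eq_of_injective hinj, natDegree_map_eq_of_injective hinj,
    resultant_map_map] at hne
  exact fun h0 => hne (by rw [h0, map_zero])

/-- Polynomials of small weight that vanish at `s` modulo an irreducible `F` of large degree have
a common irreducible factor that vanishes at `s` modulo `F`. -/
theorem exists_irreducible_dvd_of_dvd_eval {F s : 𝔽[X]} {m d : ℕ} (hF : Irreducible F)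
    (hm : 1 ≤ m) (hr : d * d * m < F.natDegree) {E : Set 𝔽[X][X]}
    (hdvd : ∀ P ∈ E, F ∣ P.eval s) (hW : ∀ P ∈ E, (weightSubst m P).natDegree ≤ d * m)
    (h0 : ∃ P ∈ E, P ≠ 0) :
    ∃ R : 𝔽[X][X], Irreducible R ∧ R.natDegree ≠ 0 ∧ (weightSubst m R).natDegree ≤ d * m ∧
      F ∣ R.eval s ∧ ∀ P ∈ E, R ∣ P := by
  obtain ⟨P, hP, hP0⟩ := h0
  obtain ⟨R, hR, hRP, hFR⟩ : ∃ R, Irreducible R ∧ R ∣ P ∧ F ∣ R.eval s := by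
    obtain ⟨f, hf, u, hu⟩ := WfDvdMonoid.exists_factors P hP0
    have h1 := hdvd P hP
    rw [← hu, eval_mul] at h1
    have hunit : IsUnit (eval s (u : 𝔽[X][X])) := u.isUnit.map (evalRingHom s)
    rw [hunit.dvd_mul_right, eval_multiset_prod] at h1
    obtain ⟨R, hRf, hFR⟩ := hF.prime.exists_mem_multiset_map_dvd h1
    exact ⟨R, hf R hRf, (Multiset.dvd_prod hRf).trans ⟨u, hu.symm⟩, hFR⟩
  have hRW := (natDegree_weightSubst_le_of_dvd (m := m) hRP hP0).trans (hW P hP)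
  have hle : d * m ≤ d * d * m := by
    rcases Nat.eq_zero_or_pos d with rfl | h
    · simp
    · exact Nat.mul_le_mul_right _ (Nat.le_mul_of_pos_left _ h)
  -- A factor free of `S` would be a nonzero polynomial in `T` of degree at most `d m < deg F`, not
  -- divisible by `F`.
  have hd0 : R.natDegree ≠ 0 := by
    intro h
    rw [eq_C_of_natDegree_eq_zero h, eval_C] at hFR
    have hc : R.coeff 0 ≠ 0 := fun h0 => hR.ne_zero (by
      rw [eq_C_of_natDegree_eq_zero h, h0, C_0])
    have h1 := natDegree_weightSubst_le_iff.1 hRW 0 hc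
    have h2 := natDegree_le_of_dvd hFR hc
    omega
  refine ⟨R, hR, hd0, hRW, hFR, fun Q hQ => ?_⟩
  by_contra hRQ
  have hres := resultant_ne_zero_of_irreducible_of_not_dvd hR hd0 hRQ
  have hdeg := natDegree_resultant_add_le hRW (hW Q hQ) hres
  have hFres : F ∣ R.resultant Q := by
    obtain ⟨p, q, -, -, h⟩ := exists_mul_add_mul_eq_C_resultant R Q le_rfl le_rfl (Or.inl hd0)
    have h1 := congrArg (eval s) h
    rw [eval_add, eval_mul, eval_mul, eval_C] at h1
    rw [← h1]
    exact dvd_add (hFR.mul_right _) ((hdvd Q hQ).mul_right _)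
  have hFle := natDegree_le_of_dvd hFres hres
  have h1 := natDegree_le_of_natDegree_weightSubst_le hm hRW
  have h2 := natDegree_le_of_natDegree_weightSubst_le hm (hW Q hQ)
  obtain ⟨x, hx⟩ := Nat.exists_eq_add_of_le h1
  obtain ⟨y, hy⟩ := Nat.exists_eq_add_of_le h2
  -- This is `(d - deg R)(d - deg Q) ≥ 0`; it bounds the degree of the resultant by `d² m`, below
  -- `deg F`.
  have h3 : R.natDegree * (d * m) + Q.natDegree * (d * m) ≤
      d * d * m + R.natDegree * Q.natDegree * m := by
    have : R.natDegree * d + Q.natDegree * d ≤ d * d + R.natDegree * Q.natDegree := by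
      zify at hx hy ⊢
      have hx' : (x : ℤ) = d - R.natDegree := by linarith
      have hy' : (y : ℤ) = d - Q.natDegree := by linarith
      have : (0 : ℤ) ≤ x * y := by positivity
      rw [hx', hy'] at this
      linarith
    calc _ = (R.natDegree * d + Q.natDegree * d) * m := by ring
      _ ≤ (d * d + R.natDegree * Q.natDegree) * m := Nat.mul_le_mul_right _ this
      _ = _ := by ring
  omega

/-- Otherwise `R` is a unit times `S + y`, and `F ∣ R(s)` becomes `F ∣ s + y`. -/
theorem eval_neg_ne_zero_of_irreducible {F s y : 𝔽[X]} {R : 𝔽[X][X]} (hR : Irreducible R)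
    (hF : F ∣ R.eval s) (hy : ¬ F ∣ s + y) : R.eval (-y) ≠ 0 := by
  intro h
  obtain ⟨c, hc⟩ := dvd_iff_isRoot.2 h
  have hu : IsUnit c := (hR.isUnit_or_isUnit hc).resolve_left (not_isUnit_X_sub_C _)
  have hu' : IsUnit (eval s c) := hu.map (evalRingHom s)
  rw [hc, eval_mul, hu'.dvd_mul_right] at hF
  exact hy (by simpa using hF)

end Resultant

/-! ### Subexponential functions -/

section Growth

/-- `f` grows more slowly than every exponential. -/
def IsSubexponential (f : ℕ → ℝ) : Prop :=
  ∀ η : ℝ, 0 < η → ∃ C : ℝ, 0 < C ∧ ∀ m : ℕ, f m ≤ C * Real.exp (η * m)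

theorem IsSubexponential.mul {f g : ℕ → ℝ} (hf : IsSubexponential f) (hg : IsSubexponential g)
    (hg0 : ∀ m, 0 ≤ g m) : IsSubexponential fun m => f m * g m := by
  intro η hη
  obtain ⟨C, hC, hfC⟩ := hf (η / 2) (by positivity)
  obtain ⟨D, hD, hgD⟩ := hg (η / 2) (by positivity)
  refine ⟨C * D, by positivity, fun m => ?_⟩
  calc f m * g m ≤ (C * Real.exp (η / 2 * m)) * (D * Real.exp (η / 2 * m)) :=
        mul_le_mul (hfC m) (hgD m) (hg0 m) (by positivity)
    _ = C * D * (Real.exp (η / 2 * m) * Real.exp (η / 2 * m)) := by ring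
    _ = _ := by rw [← Real.exp_add]; ring_nf

theorem isSubexponential_const (c : ℝ) : IsSubexponential fun _ => c := by
  intro η hη
  refine ⟨|c| + 1, by positivity, fun m => ?_⟩
  have h1 : 1 ≤ Real.exp (η * m) := Real.one_le_exp (by positivity)
  have h2 := le_abs_self c
  have h3 := abs_nonneg c
  nlinarith

theorem IsSubexponential.pow {f : ℕ → ℝ} (hf : IsSubexponential f) (hf0 : ∀ m, 0 ≤ f m) (n : ℕ) :
    IsSubexponential fun m => f m ^ n := by
  induction n with
  | zero => simpa using isSubexponential_const 1
  | succ n ih =>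
    simp only [pow_succ]
    exact ih.mul hf hf0

theorem IsSubexponential.add {f g : ℕ → ℝ} (hf : IsSubexponential f) (hg : IsSubexponential g) :
    IsSubexponential fun m => f m + g m := by
  intro η hη
  obtain ⟨C, hC, hfC⟩ := hf η hη
  obtain ⟨D, hD, hgD⟩ := hg η hη
  exact ⟨C + D, by positivity, fun m => by linarith [hfC m, hgD m]⟩

theorem isSubexponential_natCast : IsSubexponential fun m => m := by
  intro η hη
  refine ⟨1 / η, by positivity, fun m => ?_⟩
  have := Real.add_one_le_exp (η * m)
  calc (m : ℝ) = 1 / η * (η * m) := by field_simp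
    _ ≤ _ := by gcongr; linarith

theorem IsSubexponential.comp_mul {f : ℕ → ℝ} (hf : IsSubexponential f) (d : ℕ) :
    IsSubexponential fun m => f (d * m) := by
  intro η hη
  obtain ⟨C, hC, hfC⟩ := hf (η / (d + 1)) (by positivity)
  refine ⟨C, hC, fun m => (hfC _).trans
    (mul_le_mul_of_nonneg_left (Real.exp_le_exp.2 ?_) hC.le)⟩
  push_cast
  rw [div_mul_eq_mul_div, div_le_iff₀ (by positivity)]
  have : 0 ≤ η * m := by positivity
  nlinarith

theorem IsSubexponential.isLittleO_logb {f : ℕ → ℝ} (hf : IsSubexponential f) (hf1 : ∀ m, 1 ≤ f m)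
    {b : ℝ} (hb : 1 < b) :
    (fun m => Real.logb b (f m)) =o[Filter.atTop] fun m : ℕ => (m : ℝ) := by
  rw [Asymptotics.isLittleO_iff]
  intro c hc
  have hlogb : 0 < Real.log b := Real.log_pos hb
  obtain ⟨C, hC, hfC⟩ := hf (c * Real.log b / 2) (by positivity)
  obtain ⟨N, hN⟩ := exists_nat_ge (Real.log C / (c * Real.log b / 2))
  filter_upwards [Filter.eventually_ge_atTop N] with m hm
  have h0 : 0 ≤ Real.log (f m) := Real.log_nonneg (hf1 m)
  rw [Real.logb, Real.norm_of_nonneg (div_nonneg h0 hlogb.le),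
    Real.norm_of_nonneg (Nat.cast_nonneg m), div_le_iff₀ hlogb]
  have h1 : Real.log (f m) ≤ Real.log C + c * Real.log b / 2 * m := by
    rw [← Real.log_exp (c * Real.log b / 2 * m), ← Real.log_mul hC.ne' (Real.exp_pos _).ne']
    exact Real.log_le_log (by linarith [hf1 m]) (hfC m)
  have h2 : Real.log C ≤ m * (c * Real.log b / 2) := by
    rw [← div_le_iff₀ (by positivity)]
    exact hN.trans (by exact_mod_cast hm)
  linarith

/-- The largest number of divisors of a nonzero polynomial of degree at most `N`. -/
noncomputable def maxDivisors (𝔽 : Type*) [Field 𝔽] [Fintype 𝔽] (N : ℕ) : ℕ :=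
  open Classical in
  ((degreeLTFinset 𝔽 (N + 1)).erase 0).sup fun A => {D : 𝔽[X] | D ∣ A}.ncard

variable {𝔽 : Type*} [Field 𝔽] [Fintype 𝔽]

theorem ncard_setOf_dvd_le_maxDivisors {A : 𝔽[X]} {N : ℕ} (hA : A ≠ 0) (hN : A.natDegree ≤ N) :
    {D : 𝔽[X] | D ∣ A}.ncard ≤ maxDivisors 𝔽 N := by
  classical
  refine Finset.le_sup (f := fun A => {D : 𝔽[X] | D ∣ A}.ncard) ?_
  rw [Finset.mem_erase, mem_degreeLTFinset, ← natDegree_lt_iff_degree_lt hA]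
  exact ⟨hA, Nat.lt_succ_of_le hN⟩

theorem isSubexponential_maxDivisors : IsSubexponential fun N => (maxDivisors 𝔽 N : ℝ) := by
  classical
  intro η hη
  obtain ⟨C, hC, h⟩ := exists_ncard_setOf_dvd_le 𝔽 hη
  refine ⟨C, hC, fun N => ?_⟩
  obtain ⟨A, hA, hmax⟩ := Finset.exists_mem_eq_sup ((degreeLTFinset 𝔽 (N + 1)).erase 0)
    ⟨1, by simp [mem_degreeLTFinset]; exact_mod_cast Nat.succ_pos N⟩
    fun A => {D : 𝔽[X] | D ∣ A}.ncard
  rw [Finset.mem_erase, mem_degreeLTFinset] at hA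
  have hdeg : A.natDegree ≤ N := by
    have := hA.2
    rw [← natDegree_lt_iff_degree_lt hA.1] at this
    omega
  have hmax' : maxDivisors 𝔽 N = {D : 𝔽[X] | D ∣ A}.ncard := hmax
  beta_reduce
  rw [hmax']
  refine (h A hA.1).trans ?_
  gcongr

end Growth

/-! ### Assembling the energy bound -/

section Energy

variable {𝔽 : Type*} [Field 𝔽]

open scoped Classical in
/-- A finite set of tuples of small polynomials, whose reciprocal numerators are all divisible by
a fixed `R`, has about the size of its diagonal. -/
theorem card_le_of_dvd_reciprocalNumerator [Fintype 𝔽] {k m d n : ℕ} (hn : n = k + k)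
    {R : 𝔽[X][X]} {ε : Fin n → 𝔽[X]} (hε : ∀ i, IsUnit (ε i)) (hd0 : R.natDegree ≠ 0)
    (hRd : R.natDegree ≤ d) (hW : (weightSubst m R).natDegree ≤ d * m)
    {I : Finset 𝔽[X]} (hIm : ∀ y ∈ I, y.degree < m) (hIR : ∀ y ∈ I, R.eval (-y) ≠ 0)
    {S : Finset (Fin n → 𝔽[X])} (hSI : ∀ y ∈ S, ∀ t, y t ∈ I)
    (hS : ∀ y ∈ S, R ∣ reciprocalNumerator ε y) :
    (S.card : ℝ) ≤ 2 * (Fintype.card 𝔽 : ℝ) ^ (k * (m + 1)) *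
      (((d * m : ℕ) + 1) * ((maxDivisors 𝔽 (d * m) : ℝ) + 1) ^ n * d) ^ n := by
  have hB : ∀ y, ∃ B, B ∣ R.eval (-y) ∧ (R.eval (-y) ≠ 0 →
      R.eval (-y) ∣ R.leadingCoeff * B ^ R.natDegree ∧
      ∀ (n : ℕ) (ε z : Fin n → 𝔽[X]) (t : Fin n), z t = y → IsUnit (ε t) →
        R ∣ reciprocalNumerator ε z → ∀ L, (∀ j ≠ t, z j - y ∣ L) → B ∣ L) := by
    intro y
    by_cases hy : R.eval (-y) = 0
    -- The default value `0` keeps `B y ∣ R.eval (-y)` true for every `y`.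
    · exact ⟨0, by rw [hy], fun h => absurd hy h⟩
    · obtain ⟨B, h1, h2, h3⟩ := exists_conductor hy
      exact ⟨B, h1, fun _ => ⟨h2, h3⟩⟩
  choose B hBA hB using hB
  have hB0 : ∀ y ∈ I, B y ≠ 0 := fun y hy => ne_zero_of_dvd_ne_zero (hIR y hy) (hBA y)
  have hnat : ∀ y ∈ I, (R.eval (-y)).natDegree ≤ d * m := fun y hy =>
    natDegree_eval_le_of_natDegree_weightSubst_le hW (by
      rw [natDegree_neg]
      exact natDegree_le_of_degree_le (hIm y hy).le)
  refine card_le_of_sum_inv_pow_le (e := excess m B) (M := m + 1)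
    (by exact_mod_cast Fintype.card_pos) hn (I := I) ?_ hSI ?_
  · intro Y hY hYn
    refine sum_inv_pow_excess_le (A := fun y => R.eval (-y)) (by simp) hIm hIR hnat ?_ hBA ?_ ?_
      hY hYn
    · intro y hy
      have := ncard_setOf_dvd_le_maxDivisors (hIR y hy) (hnat y hy)
      have : ({D | D ∣ R.eval (-y)}.ncard : ℝ) ≤ maxDivisors 𝔽 (d * m) := by exact_mod_cast this
      linarith
    · intro y z
      have := sub_dvd_eval_sub (-y) (-z) R
      rwa [neg_sub_neg, ← neg_sub y z, neg_dvd] at this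
    · intro μ Z hZI hZμ hsep
      refine le_trans ?_ hRd
      by_contra hcon
      -- Exactly `deg R + 1` separated points, negated because `R` is evaluated at `-y`; small `B`
      -- makes these values small.
      obtain ⟨Z', hZ', hcard⟩ := Finset.exists_subset_card_eq (Nat.succ_le_of_lt (not_le.1 hcon))
      refine false_of_natDegree_eval_le_of_separated hd0 (μ := μ) (Z := Z'.image fun y => -y) ?_ ?_ ?_
      · rw [Finset.card_image_of_injective _ neg_injective, hcard]
      · intro x hx y hy hxy
        obtain ⟨a, ha, rfl⟩ := Finset.mem_image.1 hx
        obtain ⟨b, hb, rfl⟩ := Finset.mem_image.1 hy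
        rw [neg_sub_neg]
        exact hsep b (hZ' hb) a (hZ' ha) fun h => hxy (by rw [h])
      · intro x hx
        obtain ⟨a, ha, rfl⟩ := Finset.mem_image.1 hx
        have hxI := hZI (hZ' ha)
        have hl : R.leadingCoeff ≠ 0 := fun h => hd0 (by
          rw [leadingCoeff_eq_zero.1 h, natDegree_zero])
        refine (natDegree_le_of_dvd (hB a (hIR a hxI)).1
          (mul_ne_zero hl (pow_ne_zero _ (hB0 a hxI)))).trans ?_
        rw [natDegree_mul hl (pow_ne_zero _ (hB0 a hxI)), natDegree_pow]
        exact Nat.add_le_add_left (Nat.mul_le_mul_left _ (hZμ a (hZ' ha))) _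
  · intro y hy t
    exact excess_add_excess_le (hB0 _ (hSI y hy t))
      ((hB (y t) (hIR _ (hSI y hy t))).2 n ε y t rfl (hε t) (hS y hy))

/-- Tuples of small polynomials whose reciprocal numerators vanish at `s` modulo `F` have
reciprocal numerators with a common factor, whose degree and weight are bounded. -/
theorem exists_common_dvd {F s : 𝔽[X]} {m d : ℕ} (hF : Irreducible F) (hm : 1 ≤ m) (hd : 1 ≤ d)
    (hr : d * d * m < F.natDegree) {E : Set 𝔽[X][X]} (hdvd : ∀ P ∈ E, F ∣ P.eval s)
    (hW : ∀ P ∈ E, (weightSubst m P).natDegree ≤ d * m) :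
    ∃ R : 𝔽[X][X], R.natDegree ≠ 0 ∧ (weightSubst m R).natDegree ≤ d * m ∧
      (∀ y : 𝔽[X], y.degree < m → ¬ F ∣ s + y → R.eval (-y) ≠ 0) ∧ ∀ P ∈ E, R ∣ P := by
  by_cases h0 : ∃ P ∈ E, P ≠ 0
  · obtain ⟨R, hR, hR0, hRW, hFR, hRE⟩ := exists_irreducible_dvd_of_dvd_eval hF hm hr hdvd hW h0
    exact ⟨R, hR0, hRW, fun y _ hy => eval_neg_ne_zero_of_irreducible hR hFR hy, hRE⟩
  · push Not at h0
    -- If every numerator is zero, any `R` is a common divisor. `S + T^m` has weight `m`, and its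
    -- value `T^m - y` at `-y` is nonzero because `deg y < m`.
    refine ⟨X + C (X ^ m), by rw [natDegree_X_add_C]; exact one_ne_zero, ?_, ?_, ?_⟩
    · refine le_trans ?_ (Nat.le_mul_of_pos_left m hd)
      rw [natDegree_weightSubst_le_iff]
      intro j hj
      rcases j with _ | _ | j
      · rw [coeff_add, coeff_X_zero, coeff_C_zero, zero_add, natDegree_X_pow, zero_mul, add_zero]
      · rw [coeff_add, coeff_C_succ, zero_add, coeff_X_one, add_zero, natDegree_one, zero_add,
          one_mul]
      · rw [coeff_add, coeff_C_succ, coeff_X_of_ne_one (by omega), add_zero] at hj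
        exact absurd rfl hj
    · intro y hy _ h
      rw [eval_add, eval_X, eval_C, neg_add_eq_zero] at h
      rw [h, degree_X_pow] at hy
      exact lt_irrefl _ hy
    · exact fun P hP => h0 P hP ▸ dvd_zero _

theorem dvd_eval_reciprocalNumerator {n : ℕ} {F s : 𝔽[X]} {ε y v : Fin n → 𝔽[X]}
    (hv : ∀ i, F ∣ (s + y i) * v i - 1) (h : F ∣ ∑ i, ε i * v i) :
    F ∣ (reciprocalNumerator ε y).eval s := by
  have h1 : (reciprocalNumerator ε y).eval s =
      (∏ j, (s + y j)) * ∑ i, ε i * v i -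
        ∑ i, ε i * (∏ j ∈ Finset.univ.erase i, (s + y j)) * ((s + y i) * v i - 1) := by
    simp only [reciprocalNumerator, eval_finsetSum, eval_mul, eval_C, eval_prod, eval_add, eval_X]
    rw [Finset.mul_sum, ← Finset.sum_sub_distrib]
    refine Finset.sum_congr rfl fun i _ => ?_
    rw [← Finset.mul_prod_erase _ _ (Finset.mem_univ i)]
    ring
  rw [h1]
  exact dvd_sub (h.mul_left _) (Finset.dvd_sum fun i _ => (hv i).mul_left _)

theorem kloostermanEnergy_le [Fintype 𝔽] {k m : ℕ} (hk : 1 ≤ k) (hm : 1 ≤ m) {F : 𝔽[X]}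
    (hF : Irreducible F) (hr : (k + k - 1) * (k + k - 1) * m < F.natDegree) (s : 𝔽[X]) :
    (kloostermanEnergy F k (polyInterval m s) : ℝ) ≤
      2 * (Fintype.card 𝔽 : ℝ) ^ (k * (m + 1)) *
        ((((k + k - 1) * m : ℕ) + 1) * ((maxDivisors 𝔽 ((k + k - 1) * m) : ℝ) + 1) ^ (k + k) *
          (k + k - 1 : ℕ)) ^ (k + k) := by
  classical
  let ε : Fin (k + k) → 𝔽[X] := Fin.append (fun _ => 1) (fun _ => -1)
  -- For irreducible `F` the filter expresses coprimality of `x = s + y` to `F`.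
  let I : Finset 𝔽[X] := (degreeLTFinset 𝔽 m).filter fun y => ¬ F ∣ s + y
  let S : Finset (Fin (k + k) → 𝔽[X]) := (Fintype.piFinset fun _ => I).filter
    fun y => F ∣ (reciprocalNumerator ε y).eval s
  have hS : ∀ {y}, y ∈ S ↔ (∀ t, y t ∈ I) ∧ F ∣ (reciprocalNumerator ε y).eval s := fun {y} => by
    simp [S]
  have hI : ∀ {y}, y ∈ I ↔ y.degree < m ∧ ¬ F ∣ s + y := fun {y} => by
    simp [I, mem_degreeLTFinset]
  have hεu : ∀ i, IsUnit (ε i) := fun i => by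
    induction i using Fin.addCases with
    | left i => simp only [ε, Fin.append_left, isUnit_one]
    | right i => simp only [ε, Fin.append_right, isUnit_one.neg]
  have hcard : kloostermanEnergy F k (polyInterval m s) ≤ S.card := by
    rw [← Set.ncard_coe_finset S, kloostermanEnergy]
    refine Set.ncard_le_ncard_of_injOn
      (fun p t => (Fin.append p.1 p.2 : Fin (k + k) → 𝔽[X]) t - s) ?_ ?_ (Finset.finite_toSet S)
    · rintro ⟨x, z⟩ ⟨hx, hz, hxz⟩
      have hall : ∀ t, (Fin.append x z : Fin (k + k) → 𝔽[X]) t ∈ polyInterval m s ∧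
          IsCoprime ((Fin.append x z : Fin (k + k) → 𝔽[X]) t) F := fun t => by
        induction t using Fin.addCases with
        | left t => rw [Fin.append_left]; exact hx t
        | right t => rw [Fin.append_right]; exact hz t
      rw [Finset.mem_coe, hS]
      refine ⟨fun t => hI.2 ⟨(mem_polyInterval _ _ _).1 (hall t).1, fun h => ?_⟩, ?_⟩
      · rw [add_sub_cancel] at h
        exact hF.not_isUnit ((hall t).2.isUnit_of_dvd' h dvd_rfl)
      · refine dvd_eval_reciprocalNumerator
          (v := fun t => invMod F ((Fin.append x z : Fin (k + k) → 𝔽[X]) t)) (fun t => ?_) ?_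
        · rw [add_sub_cancel]
          exact dvd_mul_invMod_sub_one (hall t).2
        · simp only [Fin.sum_univ_add, ε, Fin.append_left, Fin.append_right, one_mul, neg_mul,
            Finset.sum_neg_distrib, ← sub_eq_add_neg]
          exact hxz
    · rintro ⟨x, z⟩ - ⟨x', z'⟩ - h
      have h1 : ∀ t, (Fin.append x z : Fin (k + k) → 𝔽[X]) t = Fin.append x' z' t := fun t =>
        sub_left_injective (congrFun h t)
      refine Prod.ext (funext fun t => ?_) (funext fun t => ?_)
      · simpa only [Fin.append_left] using h1 (Fin.castAdd k t)
      · simpa only [Fin.append_right] using h1 (Fin.natAdd k t)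
  obtain ⟨R, hR0, hRW, hRe, hRE⟩ := exists_common_dvd (s := s) (d := k + k - 1) hF hm (by omega) hr
    (E := reciprocalNumerator ε '' S)
    (by rintro _ ⟨y, hy, rfl⟩; exact (hS.1 hy).2)
    (by
      rintro _ ⟨y, hy, rfl⟩
      refine natDegree_weightSubst_reciprocalNumerator_le
        (fun i => natDegree_eq_zero_of_isUnit (hεu i)) fun i => ?_
      exact natDegree_le_of_degree_le (hI.1 ((hS.1 hy).1 i)).1.le)
  refine le_trans (by exact_mod_cast hcard) (card_le_of_dvd_reciprocalNumerator (S := S) rfl hεu hR0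
    (natDegree_le_of_natDegree_weightSubst_le hm hRW) hRW (I := I) (fun y hy => (hI.1 hy).1)
    (fun y hy => hRe y (hI.1 hy).1 (hI.1 hy).2) (fun y hy => (hS.1 hy).1)
    fun y hy => hRE _ ⟨y, hy, rfl⟩)

end Energy

/-! ### The theorem -/

theorem theorem2p4 {𝔽 : Type*} [Field 𝔽] [Fintype 𝔽] (k : ℕ) (hk : 2 ≤ k) :
    ∃ ε : ℕ → ℝ, Asymptotics.IsLittleO Filter.atTop ε (fun m : ℕ => (m : ℝ)) ∧
      ∀ (F : 𝔽[X]), Irreducible F → ∀ (r : ℕ), F.natDegree = r →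
      ∀ (s : 𝔽[X]) (m : ℕ), 1 ≤ m →
        (m : ℝ) < (1 - 3 * (k : ℝ) / (2 * (r : ℝ))) *
          ((r : ℝ) / (4 * (k : ℝ) ^ 2 - 4 * (k : ℝ) + 5)) →
        (kloostermanEnergy F k (polyInterval m s) : ℝ) ≤
          (Fintype.card 𝔽 : ℝ) ^ ((k : ℝ) * (m : ℝ) + ε m) := by
  have hq : (1 : ℝ) < Fintype.card 𝔽 := by exact_mod_cast Fintype.one_lt_card
  set q : ℝ := (Fintype.card 𝔽 : ℝ)
  have hq0 : 0 < q := by linarith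
  set d := k + k - 1 with hd
  have hd1 : (1 : ℝ) ≤ (d : ℕ) := by exact_mod_cast (by omega : 1 ≤ d)
  -- Everything in the energy bound except `q^{km}`; the factor `q^k` comes from the `+ 1` in `k(m +
  -- 1)`. The error term is `log_q f`.
  let f : ℕ → ℝ := fun m => 2 * q ^ k *
    ((((d * m : ℕ) : ℝ) + 1) * ((maxDivisors 𝔽 (d * m) : ℝ) + 1) ^ (k + k) * (d : ℕ)) ^ (k + k)
  have hT : IsSubexponential fun m => ((maxDivisors 𝔽 (d * m) : ℝ) + 1) :=
    (isSubexponential_maxDivisors.comp_mul d).add (isSubexponential_const 1)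
  have hf : IsSubexponential f := by
    refine (isSubexponential_const (2 * q ^ k)).mul (.pow (.mul (.mul
      ((isSubexponential_natCast.comp_mul d).add (isSubexponential_const 1))
      (hT.pow (fun m => by positivity) _) fun m => by positivity)
      (isSubexponential_const _) fun m => by positivity) (fun m => by positivity) _)
      fun m => by positivity
  have hf1 : ∀ m, 1 ≤ f m := by
    intro m
    have h1 : 1 ≤ q ^ k := one_le_pow₀ hq.le
    have h2 : (1 : ℝ) ≤ ((d * m : ℕ) : ℝ) + 1 := by
      have : (0 : ℝ) ≤ ((d * m : ℕ) : ℝ) := Nat.cast_nonneg _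
      linarith
    have h3 : (1 : ℝ) ≤ ((maxDivisors 𝔽 (d * m) : ℝ) + 1) ^ (k + k) := one_le_pow₀ (by simp)
    exact one_le_mul_of_one_le_of_one_le (one_le_mul_of_one_le_of_one_le one_le_two h1)
      (one_le_pow₀ (one_le_mul_of_one_le_of_one_le (one_le_mul_of_one_le_of_one_le h2 h3) hd1))
  refine ⟨fun m => Real.logb q (f m), hf.isLittleO_logb hf1 hq, ?_⟩
  intro F hF r hr s m hm hmr
  have hr1 : (0 : ℝ) < r := by
    rw [← hr]
    exact_mod_cast hF.natDegree_pos
  have hdm : d * d * m < F.natDegree := by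
    have hk' : (2 : ℝ) ≤ k := by exact_mod_cast hk
    have hpos : 0 < 4 * (k : ℝ) ^ 2 - 4 * (k : ℝ) + 5 := by nlinarith
    have h1 : (1 - 3 * (k : ℝ) / (2 * r)) * (r / (4 * (k : ℝ) ^ 2 - 4 * (k : ℝ) + 5)) =
        (r - 3 * k / 2) / (4 * (k : ℝ) ^ 2 - 4 * (k : ℝ) + 5) := by
      field_simp
    rw [h1, lt_div_iff₀ hpos] at hmr
    have hdk : (d : ℝ) = 2 * k - 1 := by
      rw [hd, Nat.cast_sub (by omega)]
      push_cast
      ring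
    have hm0 : (0 : ℝ) ≤ m := Nat.cast_nonneg _
    rw [hr]
    -- Here `d² = 4k² - 4k + 1`, so the hypothesis `(4k² - 4k + 5) m < r - 3k/2` is more than
    -- enough.
    have : ((d * d * m : ℕ) : ℝ) < r := by
      push_cast
      rw [hdk]
      nlinarith
    exact_mod_cast this
  refine (kloostermanEnergy_le (by omega) hm hF hdm s).trans (le_of_eq ?_)
  rw [Real.rpow_add hq0, Real.rpow_logb hq0 hq.ne' (by linarith [hf1 m]), ← Nat.cast_mul,
    Real.rpow_natCast, mul_add, mul_one, pow_add]
  simp only [f]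
  ring
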